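/- \textbf{Setting.} Let $M=\bigoplus_{i\in\mathbb Z}\mathbb Z b_i$ be the free abelian group with basis $(b_i)_{i\in\mathbb Z}$ and $\bigwedge M$ its exterior algebra. Let $F$ be the quotient of the free left $\bigwedge M$-module $\bigwedge M\otimes_{\mathbb Z}\bigoplus_{m\in\mathbb Z}\mathbb Z[\mathbf b]_m$ by the submodule generated by all $b_m\otimes[\mathbf b]_{m-1}-[\mathbf b]_m$ and $b_m\otimes[\mathbf b]_m$ ($m\in\mathbb Z$). Write $u\wedge[\mathbf b]_m$ for the class of $u\otimes[\mathbf b]_m$. For a partition $\lambda$ and any $r\ge \ell(\lambda)$ put $$[\mathbf b]_{m+\lambda}=b_{m+\lambda_1}\wedge b_{m-1+\lambda_2}\wedge\cdots\wedge b_{m-r+1+\lambda_r}\wedge[\mathbf b]_{m-r},$$ and let $F_m\subseteq F$ (the fermionic Fock space of charge $m$) be the span of all $[\mathbf b]_{m+\lambda}$. \textbf{Schubert derivations.} Let $\sigma_{\pm}(z),\overline\sigma_{\pm}(z):\bigwedge M\to(\bigwedge M)[[z^{\pm1}]]$ be the algebra homomorphisms with $\sigma_\pm(z)b_j=\sum_{i\ge0}b_{j\pm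 i}z^{\pm i}$ and $\overline\sigma_\pm(z)b_j=b_j-b_{j\pm1}z^{\pm1}$. They are extended to $F\to F[[z^{\pm1}]]$ by $D(z)(u\wedge[\mathbf b]_m)=D(z)u\wedge D(z)[\mathbf b]_m$, where $$\sigma_+(z)[\mathbf b]_m=\sigma_+(z)b_m\wedge[\mathbf b]_{m-1},\qquad \overline\sigma_+(z)[\mathbf b]_m=\sum_{j\ge0}(-1)^j[\mathbf b]_{m+(1^j)}z^j,\qquad \sigma_-(z)[\mathbf b]_m=\overline\sigma_-(z)[\mathbf b]_m=[\mathbf b]_m .$$ \textbf{The action of $gl_\infty(\mathbb Z)$.} For $i,j\in\mathbb Z$ let $\mathcal B_{ij}\in\mathrm{End}(M)$ be given by $\mathcal B_{ij}b_k=\delta_{jk}b_i$. For a finite linear combination $A$ of the $\mathcal B_{ij}$ let $\delta(A)$ be the derivation of $\bigwedge M$ extending $A$, and let $\delta_m(A)$ act on $F_m$ by $\delta_m(A)(u\wedge[\mathbf b]_k)=\delta(A)u\wedge[\mathbf b]_k$ whenever $Ab_l=0$ for all $l\le k$. Put $\delta_m(z,w)=\sum_{i,j\in\mathbb Z}\delta_m(\mathcal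 B_{ij})z^iw^{-j}$. \textbf{The $B$-module structure.} Let $B=\mathbb Z[e_1,e_2,\dots]$, $E(z)=1+\sum_{j\ge1}(-1)^je_jz^j$ and $\sum_{j\ge0}h_jz^j=1/E(z)$. Then $F$, and each $F_m$, is a $B$-module through $h_j u=\sigma_j(u)$, where $\sigma_+(z)=\sum_{j\ge0}\sigma_jz^j$. Let $i_{z,w}\frac{z}{z-w}=\sum_{k\ge0}(w/z)^k$. \textbf{Theorem (Date--Jimbo--Kashiwara--Miwa).} For every $m\in\mathbb Z$, the operators $\delta_m(\mathcal B_{ij})$ map $F_m$ into itself, and as maps from $F_m$ to the formal series in $z^{\pm1},w^{\pm1}$ with coefficients in $F_m$, $$\begin{aligned}\delta_m(z,w)&=\frac{z^m}{w^m}\,\sigma_+(z)\,\overline\sigma_-(z)\,\overline\sigma_+(w)\,\sigma_-(w)\\&=\frac{z^m}{w^m}\,i_{z,w}\frac{z}{z-w}\;\sigma_+(z)\,\overline\sigma_+(w)\,\overline\sigma_-(z)\,\sigma_-(w)\\&=\frac{z^m}{w^m}\,i_{z,w}\frac{z}{z-w}\;\frac{E(w)}{E(z)}\;\overline\sigma_-(z)\,\sigma_-(w),\end{aligned}$$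 where all products on the right are well defined: applied to any element of $F_m$, each coefficient of each successive product is a finite sum. -/

import Mathlib

open scoped TensorProduct

noncomputable section

namespace DJKM

open Finset.HasAntidiagonal (antidiagonal)

/-- The free abelian group `M = ⨁ ℤ b_i` with basis indexed by the integers. -/
abbrev FreeM : Type := ℤ →₀ ℤ

/-- The exterior algebra `⋀ M`. -/
abbrev Ext : Type := ExteriorAlgebra ℤ FreeM

/-- The basis vector `b_i` of `M`. -/
def bvec (i : ℤ) : FreeM := Finsupp.single i 1

/-- The basis vector `b_i`, viewed in `⋀ M`. -/
def bb (i : ℤ) : Ext := ExteriorAlgebra.ι ℤ (bvec i)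

/-- The shift `b_j ↦ b_{j+n}` of `M`. -/
def shift (n : ℤ) : FreeM →ₗ[ℤ] FreeM := Finsupp.lmapDomain ℤ ℤ (fun j => j + n)

@[simp] theorem shift_bvec (n j : ℤ) : shift n (bvec j) = bvec (j + n) := by
  simp [shift, bvec]

theorem shift_comm (m n : ℤ) (x : FreeM) : shift m (shift n x) = shift n (shift m x) := by
  simp only [shift, Finsupp.lmapDomain_apply, ← Finsupp.mapDomain_comp]
  congr 1
  funext j
  simp only [Function.comp]
  ring

theorem bb_mul_self (i : ℤ) : bb i * bb i = 0 := ExteriorAlgebra.ι_sq_zero _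

theorem bb_mul_bb (i j : ℤ) : bb i * bb j = -(bb j * bb i) :=
  eq_neg_of_add_eq_zero_left (ExteriorAlgebra.ι_add_mul_swap _ _)

/-! ### Hasse-Schmidt derivations of `⋀ M` -/

/-- The series `∑ a_n(x) z^n` in `(⋀ M)[[z]]`. -/
def hsLin (a : ℕ → FreeM →ₗ[ℤ] FreeM) : FreeM →ₗ[ℤ] PowerSeries Ext where
  toFun x := PowerSeries.mk fun n => ExteriorAlgebra.ι ℤ (a n x)
  map_add' x y := by ext n; simp
  map_smul' c x := by ext n; rw [PowerSeries.coeff_mk, map_smul, map_smul, RingHom.id_apply,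
    (PowerSeries.coeff n).map_smul_of_tower, PowerSeries.coeff_mk]

theorem sum_ι_mul_ι (f : ℕ → FreeM) (n : ℕ) :
    ∑ p ∈ antidiagonal n, ExteriorAlgebra.ι ℤ (f p.1) * ExteriorAlgebra.ι ℤ (f p.2) = 0 := by
  refine Finset.sum_involution (fun p _ => p.swap) ?_ ?_ ?_ ?_
  · rintro ⟨i, j⟩ _
    exact ExteriorAlgebra.ι_add_mul_swap _ _
  · rintro ⟨i, j⟩ _ h e
    apply h
    have : i = j := by simpa using (congrArg Prod.snd e)
    subst this
    exact ExteriorAlgebra.ι_sq_zero _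
  · rintro ⟨i, j⟩ h
    simpa [add_comm] using h
  · rintro ⟨i, j⟩ _
    rfl

theorem hsLin_sq (a : ℕ → FreeM →ₗ[ℤ] FreeM) (x : FreeM) : hsLin a x * hsLin a x = 0 := by
  ext n
  simp only [hsLin, LinearMap.coe_mk, AddHom.coe_mk, PowerSeries.coeff_mul, PowerSeries.coeff_mk,
    map_zero]
  exact sum_ι_mul_ι (fun k => a k x) n

/-- The unique Hasse-Schmidt derivation `D(z) : ⋀ M → (⋀ M)[[z]]` (a homomorphism of algebras)
with `D(z) x = ∑ a_n(x) z^n` for `x ∈ M`. -/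
def hs (a : ℕ → FreeM →ₗ[ℤ] FreeM) : Ext →ₐ[ℤ] PowerSeries Ext :=
  ExteriorAlgebra.lift ℤ ⟨hsLin a, hsLin_sq a⟩

@[simp] theorem hs_ι (a : ℕ → FreeM →ₗ[ℤ] FreeM) (x : FreeM) (n : ℕ) :
    PowerSeries.coeff n (hs a (ExteriorAlgebra.ι ℤ x)) = ExteriorAlgebra.ι ℤ (a n x) := by
  have h : hs a (ExteriorAlgebra.ι ℤ x) = hsLin a x :=
    ExteriorAlgebra.lift_ι_apply ℤ (hsLin a) (hsLin_sq a) x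
  rw [h]
  exact PowerSeries.coeff_mk n (fun n => ExteriorAlgebra.ι ℤ (a n x))

theorem hs_mul (a : ℕ → FreeM →ₗ[ℤ] FreeM) (u v : Ext) (n : ℕ) :
    PowerSeries.coeff n (hs a (u * v)) = ∑ p ∈ antidiagonal n,
      PowerSeries.coeff p.1 (hs a u) * PowerSeries.coeff p.2 (hs a v) := by
  rw [map_mul, PowerSeries.coeff_mul]

/-- On `M`: `σ_n b_j = b_{j+n}` (with `e = 1`), or `σ_{-n} b_j = b_{j-n}` (with `e = -1`). -/
def schubSeq (e : ℤ) (n : ℕ) : FreeM →ₗ[ℤ] FreeM := shift (e * n)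

/-- The coefficients of `x ↦ x + A(x) z`. -/
def linSeq (A : FreeM →ₗ[ℤ] FreeM) : ℕ → FreeM →ₗ[ℤ] FreeM
  | 0 => LinearMap.id
  | 1 => A
  | _ + 2 => 0

/-- The coefficients of `b_j ↦ b_j - b_{j+e} z`, which defines the inverses `σ̄_±` of `σ_±`. -/
def schubBarSeq (e : ℤ) : ℕ → FreeM →ₗ[ℤ] FreeM := linSeq (-shift e)

/-! ### The fermionic Fock space -/

/-- `⋀ M ⊗ [M]`, where `[M]` is free on the symbols `[b]_m`. -/
abbrev PreFock : Type := Ext ⊗[ℤ] (ℤ →₀ ℤ)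

/-- The element `u ⊗ [b]_m`. -/
def pre (u : Ext) (m : ℤ) : PreFock := u ⊗ₜ[ℤ] Finsupp.single m 1

/-- The `⋀ M`-submodule generated by all `b_m ⊗ [b]_{m-1} - [b]_m` and `b_m ⊗ [b]_m`. -/
def relW : Submodule Ext PreFock :=
  Submodule.span Ext
    (Set.range (fun m : ℤ => pre (bb m) (m - 1) - pre 1 m) ∪
      Set.range (fun m : ℤ => pre (bb m) m))

/-- The fermionic Fock space `F = (⋀ M ⊗ [M]) / W`. -/
def Fock : Type := PreFock ⧸ relW

instance : AddCommGroup Fock := inferInstanceAs (AddCommGroup (PreFock ⧸ relW))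

instance : Module Ext Fock := inferInstanceAs (Module Ext (PreFock ⧸ relW))

/-- The canonical projection `⋀ M ⊗ [M] → F`. -/
def proj : PreFock →ₗ[Ext] Fock := relW.mkQ

/-- The class `u ∧ [b]_m` in `F`. -/
def wedgeVac (u : Ext) (m : ℤ) : Fock := proj (pre u m)

theorem smul_pre (u v : Ext) (m : ℤ) : u • pre v m = pre (u * v) m := by
  simp [pre, TensorProduct.smul_tmul']

theorem smul_wedgeVac (u v : Ext) (m : ℤ) : u • wedgeVac v m = wedgeVac (u * v) m := by
  rw [wedgeVac, ← map_smul, smul_pre, wedgeVac]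

theorem wedgeVac_zero (m : ℤ) : wedgeVac 0 m = 0 := by
  simp [wedgeVac, pre]

theorem wedgeVac_add (u v : Ext) (m : ℤ) : wedgeVac (u + v) m = wedgeVac u m + wedgeVac v m := by
  simp [wedgeVac, pre, TensorProduct.add_tmul]

theorem wedgeVac_neg (u : Ext) (m : ℤ) : wedgeVac (-u) m = -wedgeVac u m := by
  simp [wedgeVac, pre, TensorProduct.neg_tmul]

theorem wedgeVac_bb_sub_one (u : Ext) (m : ℤ) : wedgeVac (u * bb m) (m - 1) = wedgeVac u m := by
  have h : (pre (bb m) (m - 1) - pre 1 m) ∈ relW :=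
    Submodule.subset_span (Or.inl ⟨m, rfl⟩)
  have h2 : proj (pre (bb m) (m - 1) - pre 1 m) = 0 := (Submodule.Quotient.mk_eq_zero _).2 h
  rw [map_sub, sub_eq_zero] at h2
  have h3 := congrArg (fun t => u • t) h2
  rwa [← map_smul, ← map_smul, smul_pre, smul_pre, mul_one] at h3

theorem wedgeVac_bb_self (u : Ext) (m : ℤ) : wedgeVac (u * bb m) m = 0 := by
  have h : pre (bb m) m ∈ relW := Submodule.subset_span (Or.inr ⟨m, rfl⟩)
  have h2 : proj (pre (bb m) m) = 0 := (Submodule.Quotient.mk_eq_zero _).2 h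
  have h3 := congrArg (fun t => u • t) h2
  rwa [← map_smul, smul_pre, smul_zero] at h3

/-- `b_j ∧ [b]_m = 0` for `j ≤ m`. -/
theorem wedgeVac_bb_of_le (n : ℕ) (u : Ext) (j : ℤ) :
    wedgeVac (u * bb j) (j + n) = 0 := by
  induction n generalizing u with
  | zero => simpa using wedgeVac_bb_self u j
  | succ k ih =>
    rw [← wedgeVac_bb_sub_one (u * bb j), mul_assoc, bb_mul_bb, mul_neg, ← mul_assoc, wedgeVac_neg]
    have : j + ((k + 1 : ℕ) : ℤ) - 1 = j + k := by push_cast; ring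
    rw [this, ih, neg_zero]

theorem wedgeVac_bb_le (u : Ext) {j m : ℤ} (h : j ≤ m) : wedgeVac (u * bb j) m = 0 := by
  obtain ⟨n, rfl⟩ := Int.le.dest h
  exact wedgeVac_bb_of_le n u j

/-- A family of additive maps `u ↦ L_m(u)`, to be thought of as `u ⊗ [b]_m ↦ L_m(u)`, induces a map
on `⋀ M ⊗ [M]`. -/
def preLift (L : ℤ → Ext →ₗ[ℤ] Fock) : PreFock →+ Fock :=
  (TensorProduct.lift (Finsupp.linearCombination ℤ L).flip).toAddMonoidHom

@[simp] theorem preLift_pre (L : ℤ → Ext →ₗ[ℤ] Fock) (u : Ext) (m : ℤ) :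
    preLift L (pre u m) = L m u := by
  have h : preLift L (pre u m) = Finsupp.linearCombination ℤ L (Finsupp.single m 1) u :=
    TensorProduct.lift.tmul (f' := (Finsupp.linearCombination ℤ L).flip) u (Finsupp.single m 1)
  rw [h, Finsupp.linearCombination_single, one_smul]

theorem pre_induction {p : PreFock → Prop} (hadd : ∀ x y, p x → p y → p (x + y))
    (hp : ∀ u m, p (pre u m)) (x : PreFock) : p x := by
  have h0 : p 0 := by simpa [pre] using hp 0 0
  induction x using TensorProduct.induction_on with
  | zero => exact h0
  | add x y hx hy => exact hadd x y hx hy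
  | tmul u f =>
    induction f using Finsupp.induction_linear with
    | zero => simpa using h0
    | add f g hf hg => rw [TensorProduct.tmul_add]; exact hadd _ _ hf hg
    | single m c =>
      have : u ⊗ₜ[ℤ] (Finsupp.single m c : ℤ →₀ ℤ) = pre (c • u) m := by
        rw [pre, TensorProduct.smul_tmul, Finsupp.smul_single]; simp
      rw [this]; exact hp _ _

theorem preLift_relW (L : ℤ → Ext →ₗ[ℤ] Fock)
    (h1 : ∀ u m, L (m - 1) (u * bb m) = L m u) (h2 : ∀ u m, L m (u * bb m) = 0)
    (x : PreFock) (hx : x ∈ relW) : preLift L x = 0 := by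
  refine Submodule.span_induction (p := fun x _ => ∀ u : Ext, preLift L (u • x) = 0)
    ?_ ?_ ?_ ?_ hx 1 |> fun h => by simpa using h
  · rintro _ (⟨m, rfl⟩ | ⟨m, rfl⟩) u
    · simp only [smul_sub, smul_pre, map_sub, preLift_pre, mul_one, h1, sub_self]
    · simp only [smul_pre, preLift_pre, h2]
  · intro u; simp
  · intro x y _ _ hx hy u; rw [smul_add, map_add, hx, hy, add_zero]
  · intro v x _ hx u; rw [smul_smul]; exact hx _

/-- The endomorphism `u ∧ [b]_m ↦ L_m(u)` of `F`. -/
def fockLift (L : ℤ → Ext →ₗ[ℤ] Fock)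
    (h1 : ∀ u m, L (m - 1) (u * bb m) = L m u) (h2 : ∀ u m, L m (u * bb m) = 0) :
    Module.End ℤ Fock :=
  (QuotientAddGroup.lift relW.toAddSubgroup (preLift L)
    (fun x hx => preLift_relW L h1 h2 x hx)).toIntLinearMap

@[simp] theorem fockLift_wedgeVac (L : ℤ → Ext →ₗ[ℤ] Fock) (h1) (h2) (u : Ext) (m : ℤ) :
    fockLift L h1 h2 (wedgeVac u m) = L m u :=
  preLift_pre L u m

theorem fock_induction {p : Fock → Prop} (hadd : ∀ x y, p x → p y → p (x + y))
    (hp : ∀ u m, p (wedgeVac u m)) (x : Fock) : p x := by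
  obtain ⟨y, rfl⟩ := Submodule.Quotient.mk_surjective relW x
  exact pre_induction (p := fun y => p (proj y)) (fun x y hx hy => by rw [map_add]; exact hadd _ _ hx hy)
    hp y

/-- `b_{m+λ_1} ∧ b_{m-1+λ_2} ∧ ⋯ ∧ b_{m-r+1+λ_r}`. -/
def bPart (m : ℤ) {r : ℕ} (lam : Fin r → ℕ) : Ext :=
  (List.ofFn fun i : Fin r => bb (m - (i : ℕ) + lam i)).prod

/-- `[b]_{m+λ} = b^r_{m+λ} ∧ [b]_{m-r}` for a partition `λ` of length at most `r`. -/
def fockBasis (m : ℤ) {r : ℕ} (lam : Fin r → ℕ) : Fock := wedgeVac (bPart m lam) (m - r)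

/-- The Fock space `F_m` of charge `m`, spanned by all `[b]_{m+λ}`. -/
def fockCharge (m : ℤ) : Submodule ℤ Fock :=
  Submodule.span ℤ {x | ∃ (r : ℕ) (lam : Fin r → ℕ), Antitone lam ∧ x = fockBasis m lam}

/-! ### The Schubert derivations on the Fock space -/

theorem sum_antidiagonal_assoc {A : Type} [AddCommMonoid A] (n : ℕ) (f : ℕ → ℕ → ℕ → A) :
    ∑ p ∈ antidiagonal n, ∑ q ∈ antidiagonal p.1, f q.1 q.2 p.2 =
      ∑ p ∈ antidiagonal n, ∑ q ∈ antidiagonal p.2, f p.1 q.1 q.2 := by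
  rw [Finset.sum_sigma', Finset.sum_sigma']
  refine Finset.sum_nbij' (fun x => ⟨(x.2.1, x.2.2 + x.1.2), (x.2.2, x.1.2)⟩)
    (fun x => ⟨(x.1.1 + x.2.1, x.2.2), (x.1.1, x.2.1)⟩) ?_ ?_ ?_ ?_ ?_
  · rintro ⟨⟨a, b⟩, ⟨c, d⟩⟩ h
    simp at h ⊢
    omega
  · rintro ⟨⟨a, b⟩, ⟨c, d⟩⟩ h
    simp at h ⊢
    omega
  · rintro ⟨⟨a, b⟩, ⟨c, d⟩⟩ h
    simp at h ⊢
    omega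
  · rintro ⟨⟨a, b⟩, ⟨c, d⟩⟩ h
    simp at h ⊢
    omega
  · rintro ⟨⟨a, b⟩, ⟨c, d⟩⟩ h
    rfl

/-- The map `u ↦ n`-th coefficient of `D(z)u ∧ φ(z)`. -/
def hsExtLin (a : ℕ → FreeM →ₗ[ℤ] FreeM) (φ : ℤ → ℕ → Fock) (n : ℕ) (m : ℤ) : Ext →ₗ[ℤ] Fock :=
  AddMonoidHom.toIntLinearMap
    { toFun := fun u => ∑ p ∈ antidiagonal n, PowerSeries.coeff p.1 (hs a u) • φ m p.2
      map_zero' := by simp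
      map_add' := fun u v => by simp [add_smul, Finset.sum_add_distrib] }

theorem hsExtLin_apply (a : ℕ → FreeM →ₗ[ℤ] FreeM) (φ : ℤ → ℕ → Fock) (n : ℕ) (m : ℤ) (u : Ext) :
    hsExtLin a φ n m u =
      ∑ p ∈ antidiagonal n, PowerSeries.coeff p.1 (hs a u) • φ m p.2 := rfl

theorem hsExtLin_mul (a : ℕ → FreeM →ₗ[ℤ] FreeM) (φ : ℤ → ℕ → Fock) (n : ℕ) (m : ℤ) (u v : Ext) :
    hsExtLin a φ n m (u * v) =
      ∑ p ∈ antidiagonal n, PowerSeries.coeff p.1 (hs a u) • hsExtLin a φ p.2 m v := by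
  simp only [hsExtLin_apply, hs_mul, Finset.sum_smul, Finset.smul_sum, mul_smul]
  exact sum_antidiagonal_assoc n fun i j k =>
    PowerSeries.coeff i (hs a u) • PowerSeries.coeff j (hs a v) • φ m k

/-- Given the Hasse-Schmidt derivation `D(z)` of `⋀ M` and the values `D(z)[b]_m = φ_m(z)`, the `n`-th
coefficient of the map `D(z)(u ∧ [b]_m) = D(z)u ∧ φ_m(z)` on `F`. -/
def hsExt (a : ℕ → FreeM →ₗ[ℤ] FreeM) (φ : ℤ → ℕ → Fock)
    (h1 : ∀ n m, hsExtLin a φ n (m - 1) (bb m) = φ m n)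
    (h2 : ∀ n m, hsExtLin a φ n m (bb m) = 0) (n : ℕ) : Module.End ℤ Fock :=
  fockLift (hsExtLin a φ n)
    (fun u m => by simp only [hsExtLin_mul, h1]; rfl)
    (fun u m => by simp only [hsExtLin_mul, h2, smul_zero, Finset.sum_const_zero])

theorem hsExt_wedgeVac (a : ℕ → FreeM →ₗ[ℤ] FreeM) (φ : ℤ → ℕ → Fock) (h1) (h2) (n : ℕ)
    (u : Ext) (m : ℤ) :
    hsExt a φ h1 h2 n (wedgeVac u m) =
      ∑ p ∈ antidiagonal n, PowerSeries.coeff p.1 (hs a u) • φ m p.2 := by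
  rw [hsExt, fockLift_wedgeVac, hsExtLin_apply]

theorem hsExt_smul (a : ℕ → FreeM →ₗ[ℤ] FreeM) (φ : ℤ → ℕ → Fock) (h1) (h2) (n : ℕ)
    (u : Ext) (x : Fock) :
    hsExt a φ h1 h2 n (u • x) =
      ∑ p ∈ antidiagonal n, PowerSeries.coeff p.1 (hs a u) • hsExt a φ h1 h2 p.2 x := by
  induction x using fock_induction with
  | hadd x y hx hy => simp only [smul_add, map_add, hx, hy, Finset.sum_add_distrib]
  | hp v m =>
    rw [smul_wedgeVac]
    simp only [hsExt, fockLift_wedgeVac]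
    exact hsExtLin_mul _ _ _ _ _ _

/-- `σ_+(z)[b]_m = σ_+(z)b_m ∧ [b]_{m-1}`. -/
def phiPlus (m : ℤ) (n : ℕ) : Fock := wedgeVac (bb (m + n)) (m - 1)

/-- `σ_-(z)[b]_m = σ̄_-(z)[b]_m = [b]_m`. -/
def phiMinus (m : ℤ) (n : ℕ) : Fock := if n = 0 then wedgeVac 1 m else 0

/-- `σ̄_+(z)[b]_m = ∑ (-1)^n [b]_{m+(1^n)} z^n`. -/
def phiBarPlus (m : ℤ) (n : ℕ) : Fock := (-1 : ℤ) ^ n • fockBasis m (fun _ : Fin n => 1)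

theorem schubSeq_ι (e : ℤ) (n : ℕ) (m : ℤ) :
    ExteriorAlgebra.ι ℤ (schubSeq e n (bvec m)) = bb (m + e * n) := by
  rw [schubSeq, shift_bvec, bb]

theorem bPart_const_succ (c : ℕ) (m : ℤ) (n : ℕ) :
    bPart m (fun _ : Fin (n + 1) => c) = bb (m + c) * bPart (m - 1) (fun _ : Fin n => c) := by
  simp only [bPart, List.ofFn_succ, List.prod_cons, Fin.val_zero, Fin.val_succ]
  congr 1
  · simp
  · congr 2
    funext i
    congr 1
    push_cast
    ring

@[simp] theorem bPart_zero (m : ℤ) (lam : Fin 0 → ℕ) : bPart m lam = 1 := by simp [bPart]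

theorem plus_h1 (n : ℕ) (m : ℤ) :
    hsExtLin (schubSeq 1) phiPlus n (m - 1) (bb m) = phiPlus m n := by
  simp only [hsExtLin_apply, bb, hs_ι]
  simp only [schubSeq_ι, phiPlus, smul_wedgeVac]
  cases n with
  | zero =>
    simp only [Finset.HasAntidiagonal.antidiagonal_zero, Finset.sum_singleton]
    simpa using wedgeVac_bb_sub_one (bb m) (m - 1)
  | succ k =>
    rw [Finset.Nat.sum_antidiagonal_succ']
    have h0 : ∑ p ∈ antidiagonal k,
        wedgeVac (bb (m + 1 * (p.1 : ℤ)) * bb (m - 1 + ((p.2 + 1 : ℕ) : ℤ))) (m - 1 - 1) = 0 := by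
      have := sum_ι_mul_ι (fun i => bvec (m + i)) k
      have h2 := congrArg (fun t => wedgeVac t (m - 1 - 1)) this
      have key : ∀ s : Finset (ℕ × ℕ), wedgeVac (∑ p ∈ s, bb (m + p.1) * bb (m + p.2)) (m - 1 - 1)
          = ∑ p ∈ s, wedgeVac (bb (m + p.1) * bb (m + p.2)) (m - 1 - 1) := fun s =>
        map_sum (AddMonoidHom.mk' (fun t => wedgeVac t (m - 1 - 1))
          (fun x y => wedgeVac_add x y _)) _ _
      simp only [wedgeVac_zero] at h2
      rw [← h2]
      refine Eq.trans ?_ (key _).symm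
      refine Finset.sum_congr rfl fun p _ => ?_
      have e : m - 1 + ((p.2 + 1 : ℕ) : ℤ) = m + p.2 := by push_cast; ring
      rw [e, one_mul]
    rw [h0]
    simpa using wedgeVac_bb_sub_one (bb (m + ((k : ℤ) + 1))) (m - 1)

theorem plus_h2 (n : ℕ) (m : ℤ) :
    hsExtLin (schubSeq 1) phiPlus n m (bb m) = 0 := by
  simp only [hsExtLin_apply, bb, hs_ι]
  simp only [schubSeq_ι, phiPlus, smul_wedgeVac, one_mul]
  have := sum_ι_mul_ι (fun i => bvec (m + i)) n
  have h2 := congrArg (fun t => wedgeVac t (m - 1)) this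
  simp only [wedgeVac_zero] at h2
  rw [← h2]
  exact (map_sum (AddMonoidHom.mk' (fun t => wedgeVac t (m - 1))
    (fun x y => wedgeVac_add x y _)) _ _).symm

theorem hsExtLin_phiMinus (a : ℕ → FreeM →ₗ[ℤ] FreeM) (n : ℕ) (m : ℤ) (u : Ext) :
    hsExtLin a phiMinus n m u = wedgeVac (PowerSeries.coeff n (hs a u)) m := by
  rw [hsExtLin_apply, Finset.sum_eq_single (n, 0)]
  · simp [phiMinus, smul_wedgeVac]
  · rintro ⟨i, j⟩ h hne
    have : j ≠ 0 := by
      rintro rfl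
      simp at h
      exact hne (by simp [h])
    simp [phiMinus, this]
  · intro h
    simp at h

theorem minus_h1 (n : ℕ) (m : ℤ) :
    hsExtLin (schubSeq (-1)) phiMinus n (m - 1) (bb m) = phiMinus m n := by
  rw [hsExtLin_phiMinus, bb, hs_ι, schubSeq_ι, phiMinus]
  split_ifs with h
  · subst h
    simpa using wedgeVac_bb_sub_one 1 m
  · simpa using wedgeVac_bb_le 1 (j := m + -1 * (n : ℤ)) (m := m - 1) (by omega)

theorem minus_h2 (n : ℕ) (m : ℤ) :
    hsExtLin (schubSeq (-1)) phiMinus n m (bb m) = 0 := by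
  rw [hsExtLin_phiMinus, bb, hs_ι, schubSeq_ι]
  simpa using wedgeVac_bb_le 1 (j := m + -1 * (n : ℤ)) (m := m) (by omega)

theorem barMinus_h1 (n : ℕ) (m : ℤ) :
    hsExtLin (schubBarSeq (-1)) phiMinus n (m - 1) (bb m) = phiMinus m n := by
  rw [hsExtLin_phiMinus, bb, hs_ι, phiMinus]
  match n with
  | 0 => simpa [schubBarSeq, linSeq, bb] using wedgeVac_bb_sub_one 1 m
  | 1 =>
    have := wedgeVac_bb_le 1 (j := m - 1) (m := m - 1) le_rfl
    rw [one_mul, bb] at this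
    simp [schubBarSeq, linSeq, wedgeVac_neg, this, ← sub_eq_add_neg]
  | k + 2 => simp [schubBarSeq, linSeq, wedgeVac_zero]

theorem barMinus_h2 (n : ℕ) (m : ℤ) :
    hsExtLin (schubBarSeq (-1)) phiMinus n m (bb m) = 0 := by
  rw [hsExtLin_phiMinus, bb, hs_ι]
  match n with
  | 0 => simpa [schubBarSeq, linSeq, bb] using wedgeVac_bb_self 1 m
  | 1 =>
    have := wedgeVac_bb_le 1 (j := m - 1) (m := m) (by omega)
    rw [one_mul, bb] at this
    simp [schubBarSeq, linSeq, wedgeVac_neg, this, ← sub_eq_add_neg]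
  | k + 2 => simp [schubBarSeq, linSeq, wedgeVac_zero]

theorem hsExtLin_bar_zero (e : ℤ) (φ : ℤ → ℕ → Fock) (m k : ℤ) :
    hsExtLin (schubBarSeq e) φ 0 k (bb m) = bb m • φ k 0 := by
  simp [hsExtLin_apply, bb, hs_ι, schubBarSeq, linSeq]

theorem hsExtLin_bar_succ (e : ℤ) (φ : ℤ → ℕ → Fock) (n : ℕ) (m k : ℤ) :
    hsExtLin (schubBarSeq e) φ (n + 1) k (bb m) = bb m • φ k (n + 1) - bb (m + e) • φ k n := by
  simp only [hsExtLin_apply, bb, hs_ι]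
  rw [Finset.Nat.sum_antidiagonal_succ]
  cases n with
  | zero => simp [schubBarSeq, linSeq, sub_eq_add_neg]
  | succ n =>
    rw [Finset.Nat.sum_antidiagonal_succ]
    simp [schubBarSeq, linSeq, sub_eq_add_neg]

theorem barPlus_h1 (n : ℕ) (m : ℤ) :
    hsExtLin (schubBarSeq 1) phiBarPlus n (m - 1) (bb m) = phiBarPlus m n := by
  cases n with
  | zero =>
    rw [hsExtLin_bar_zero]
    simpa [phiBarPlus, fockBasis, smul_wedgeVac] using wedgeVac_bb_sub_one 1 m
  | succ n =>
    rw [hsExtLin_bar_succ]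
    have e : m - 1 - (n : ℤ) = m - ((n + 1 : ℕ) : ℤ) := by push_cast; ring
    simp only [phiBarPlus, fockBasis, smul_comm (bb _) ((-1 : ℤ) ^ _), smul_wedgeVac]
    rw [bPart_const_succ 1 (m - 1), bPart_const_succ 1 m]
    rw [← mul_assoc, Nat.cast_one, sub_add_cancel, bb_mul_self, zero_mul, wedgeVac_zero, e, pow_succ]
    simp

theorem barPlus_h2 (n : ℕ) (m : ℤ) :
    hsExtLin (schubBarSeq 1) phiBarPlus n m (bb m) = 0 := by
  match n with
  | 0 =>
    rw [hsExtLin_bar_zero]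
    simpa [phiBarPlus, fockBasis, smul_wedgeVac] using wedgeVac_bb_self 1 m
  | 1 =>
    rw [hsExtLin_bar_succ]
    have h := wedgeVac_bb_sub_one (bb (m + 1)) m
    simp only [phiBarPlus, fockBasis, smul_comm (bb _) ((-1 : ℤ) ^ _), smul_wedgeVac]
    rw [bPart_const_succ 1 m, bPart_zero, bPart_zero, mul_one, mul_one, Nat.cast_one, bb_mul_bb]
    simp [wedgeVac_neg, h]
  | n + 2 =>
    rw [hsExtLin_bar_succ]
    simp only [phiBarPlus, fockBasis, smul_comm (bb _) ((-1 : ℤ) ^ _), smul_wedgeVac]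
    rw [bPart_const_succ 1 m, bPart_const_succ 1 m, bPart_const_succ 1 (m - 1)]
    simp only [Nat.cast_one, sub_add_cancel]
    rw [← mul_assoc (bb (m + 1)) (bb (m + 1)), bb_mul_self, zero_mul, ← mul_assoc, ← mul_assoc,
      bb_mul_bb m, neg_mul, mul_assoc (bb (m + 1)), bb_mul_self]
    simp [wedgeVac_zero]

/-- The coefficient of `z^n` in `σ_+(z) : F → F[[z]]`, for a natural number `n`. -/
def sigmaPlusN : ℕ → Module.End ℤ Fock := hsExt (schubSeq 1) phiPlus plus_h1 plus_h2

/-- The coefficient of `z^n` in a series `∑_{k ≥ 0} f_k z^k`, for an integer `n`. -/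
def posCoeff {A : Type*} [Zero A] (f : ℕ → A) (n : ℤ) : A := if 0 ≤ n then f n.toNat else 0

/-- The coefficient of `z^n` in `σ_+(z) : F → F[[z]]`. -/
def sigmaPlus (n : ℤ) : Module.End ℤ Fock := posCoeff sigmaPlusN n

/-- The coefficient of `z^n` in `σ_-(z) : F → F[[z⁻¹]]`. -/
def sigmaMinus (n : ℤ) : Module.End ℤ Fock :=
  posCoeff (hsExt (schubSeq (-1)) phiMinus minus_h1 minus_h2) (-n)

/-- The coefficient of `z^n` in `σ̄_+(z) : F → F[[z]]`. -/
def sigmaBarPlus (n : ℤ) : Module.End ℤ Fock :=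
  posCoeff (hsExt (schubBarSeq 1) phiBarPlus barPlus_h1 barPlus_h2) n

/-- The coefficient of `z^n` in `σ̄_-(z) : F → F[[z⁻¹]]`. -/
def sigmaBarMinus (n : ℤ) : Module.End ℤ Fock :=
  posCoeff (hsExt (schubBarSeq (-1)) phiMinus barMinus_h1 barMinus_h2) (-n)

/-! ### The action of `gl_∞` -/

theorem hs_algebraMap (a : ℕ → FreeM →ₗ[ℤ] FreeM) (r : ℤ) (n : ℕ) :
    PowerSeries.coeff n (hs a (algebraMap ℤ Ext r)) = if n = 0 then algebraMap ℤ Ext r else 0 := by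
  have h : hs a (algebraMap ℤ Ext r) = PowerSeries.C (algebraMap ℤ Ext r) := by
    simp
  rw [h, PowerSeries.coeff_C]

theorem hs_coeff_zero (a : ℕ → FreeM →ₗ[ℤ] FreeM) (h : ∀ x, a 0 x = x) (u : Ext) :
    PowerSeries.coeff 0 (hs a u) = u := by
  induction u using ExteriorAlgebra.induction with
  | algebraMap r => rw [hs_algebraMap, if_pos rfl]
  | ι x => rw [hs_ι, h]
  | mul u v hu hv => rw [hs_mul, Finset.HasAntidiagonal.antidiagonal_zero, Finset.sum_singleton, hu, hv]
  | add u v hu hv => rw [map_add, map_add, hu, hv]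

/-- The derivation `δ(A)` of `⋀ M` extending `A ∈ End(M)`: the first-order coefficient of the
algebra homomorphism with `x ↦ x + A(x) z`. -/
def deltaExt (A : Module.End ℤ FreeM) : Module.End ℤ Ext :=
  AddMonoidHom.toIntLinearMap
    { toFun := fun u => PowerSeries.coeff 1 (hs (linSeq A) u)
      map_zero' := by simp
      map_add' := fun u v => by simp }

theorem deltaExt_ι (A : Module.End ℤ FreeM) (x : FreeM) :
    deltaExt A (ExteriorAlgebra.ι ℤ x) = ExteriorAlgebra.ι ℤ (A x) :=
  hs_ι (linSeq A) x 1

theorem deltaExt_mul (A : Module.End ℤ FreeM) (u v : Ext) :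
    deltaExt A (u * v) = deltaExt A u * v + u * deltaExt A v := by
  have h := hs_mul (linSeq A) u v 1
  rw [Finset.Nat.sum_antidiagonal_succ, Finset.HasAntidiagonal.antidiagonal_zero, Finset.sum_singleton,
    hs_coeff_zero _ (fun _ => rfl), hs_coeff_zero _ (fun _ => rfl)] at h
  exact h.trans (add_comm _ _)

theorem deltaExt_bPart (A : Module.End ℤ FreeM) (N : ℤ) (hA : ∀ l ≤ N, A (bvec l) = 0)
    {l : ℤ} (h : l ≤ N) : deltaExt A (bb l) = 0 := by
  rw [bb, deltaExt_ι, hA l h, map_zero]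

/-- `b_k ∧ b_{k-1} ∧ ⋯ ∧ b_{N+1}` (the empty product when `k ≤ N`). -/
def bDown (k N : ℤ) : Ext := bPart k (fun _ : Fin (k - N).toNat => 0)

theorem bDown_of_le {k N : ℤ} (h : k ≤ N) : bDown k N = 1 := by
  have h0 : (k - N).toNat = 0 := by omega
  rw [bDown, h0, bPart_zero]

theorem bDown_of_lt {k N : ℤ} (h : N < k) : bDown k N = bb k * bDown (k - 1) N := by
  have h0 : (k - N).toNat = (k - 1 - N).toNat + 1 := by omega
  rw [bDown, h0, bPart_const_succ, bDown]
  simp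

/-- `u ∧ [b]_k ↦ δ(A)(u ∧ b_k ∧ ⋯ ∧ b_{N+1}) ∧ [b]_{min(k,N)}`, where `A` kills all `b_l`, `l ≤ N`. -/
def deltaFockAux (A : Module.End ℤ FreeM) (N : ℤ) (hA : ∀ l ≤ N, A (bvec l) = 0) :
    Module.End ℤ Fock :=
  fockLift
    (fun k => AddMonoidHom.toIntLinearMap
      { toFun := fun u => wedgeVac (deltaExt A (u * bDown k N)) (min k N)
        map_zero' := by simp [wedgeVac_zero]
        map_add' := fun u v => by simp [add_mul, wedgeVac_add] })
    (fun u m => by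
      change wedgeVac (deltaExt A (u * bb m * bDown (m - 1) N)) (min (m - 1) N) =
        wedgeVac (deltaExt A (u * bDown m N)) (min m N)
      rcases le_or_gt m N with h | h
      · rw [bDown_of_le h, bDown_of_le (by omega), mul_one, mul_one, min_eq_left h,
          min_eq_left (by omega), deltaExt_mul, deltaExt_bPart A N hA h, mul_zero, add_zero,
          wedgeVac_bb_sub_one]
      · rw [bDown_of_lt h, mul_assoc, min_eq_right h.le, min_eq_right (by omega)])
    (fun u m => by
      change wedgeVac (deltaExt A (u * bb m * bDown m N)) (min m N) = 0
      rcases le_or_gt m N with h | h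
      · rw [bDown_of_le h, mul_one, min_eq_left h, deltaExt_mul, deltaExt_bPart A N hA h, mul_zero,
          add_zero, wedgeVac_bb_self]
      · rw [bDown_of_lt h, mul_assoc, ← mul_assoc (bb m), bb_mul_self, zero_mul, mul_zero, map_zero,
          wedgeVac_zero])

open Classical in
/-- The action of `A ∈ gl_∞` on `F`, `δ(A)(u ∧ [b]_k) = δ(A)u ∧ [b]_k` whenever `A` kills all `b_l`
with `l ≤ k`. Every `A ∈ gl_∞` (a finite combination of elementary matrices) kills all `b_l` with
`l ≪ 0`; for the other endomorphisms of `M` the value is set to zero. -/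
def deltaFock (A : Module.End ℤ FreeM) : Module.End ℤ Fock :=
  if h : ∃ N, ∀ l ≤ N, A (bvec l) = 0 then deltaFockAux A h.choose h.choose_spec else 0

theorem wedgeVac_mul_bDown (u : Ext) (N : ℤ) (n : ℕ) :
    wedgeVac (u * bDown (N + n) N) N = wedgeVac u (N + n) := by
  induction n generalizing u with
  | zero => simp [bDown_of_le]
  | succ n ih =>
    rw [bDown_of_lt (by push_cast; omega), ← mul_assoc]
    have e : N + ((n + 1 : ℕ) : ℤ) - 1 = N + n := by push_cast; ring
    rw [e, ih, ← e, wedgeVac_bb_sub_one]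

theorem deltaFock_wedgeVac (A : Module.End ℤ FreeM) (k : ℤ) (hA : ∀ l ≤ k, A (bvec l) = 0)
    (u : Ext) : deltaFock A (wedgeVac u k) = wedgeVac (deltaExt A u) k := by
  have h : ∃ N, ∀ l ≤ N, A (bvec l) = 0 := ⟨k, hA⟩
  rw [deltaFock, dif_pos h]
  obtain ⟨N, hN, e⟩ : ∃ (N : ℤ) (hN : ∀ l ≤ N, A (bvec l) = 0),
      deltaFockAux A h.choose h.choose_spec = deltaFockAux A N hN := ⟨_, _, rfl⟩
  rw [e]
  rw [deltaFockAux, fockLift_wedgeVac]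
  change wedgeVac (deltaExt A (u * bDown k N)) (min k N) = _
  rcases le_or_gt k N with hk | hk
  · rw [bDown_of_le hk, mul_one, min_eq_left hk]
  · obtain ⟨n, rfl⟩ := Int.le.dest hk.le
    have h0 : ∀ j : ℕ, j ≤ n → deltaExt A (bDown (N + j) N) = 0 := by
      intro j
      induction j with
      | zero =>
        intro _
        have h1 : deltaExt A 1 = 0 := by simpa using deltaExt_mul A 1 1
        rw [bDown_of_le (by simp), h1]
      | succ j ih =>
        intro hj
        rw [bDown_of_lt (by push_cast; omega), deltaExt_mul]
        have e : N + ((j + 1 : ℕ) : ℤ) - 1 = N + j := by push_cast; ring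
        rw [e, ih (by omega), deltaExt_bPart A _ hA (by omega), zero_mul, mul_zero, add_zero]
    rw [deltaExt_mul, h0 n le_rfl, mul_zero, add_zero, min_eq_right hk.le, wedgeVac_mul_bDown]

/-- The elementary matrix `B_{ij} = b_i ⊗ β_j`, i.e. `b_k ↦ δ_{jk} b_i`. -/
def elemMat (i j : ℤ) : Module.End ℤ FreeM := Finsupp.lsingle i ∘ₗ Finsupp.lapply j

theorem elemMat_bvec (i j k : ℤ) : elemMat i j (bvec k) = if k = j then bvec i else 0 := by
  by_cases h : k = j <;> simp [elemMat, bvec, h]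

/-! ### The boson-fermion correspondence -/

theorem hs_comm (a c : ℕ → FreeM →ₗ[ℤ] FreeM) (hac : ∀ i j x, a i (c j x) = c j (a i x))
    (u : Ext) : ∀ i j : ℕ, PowerSeries.coeff i (hs a (PowerSeries.coeff j (hs c u))) =
      PowerSeries.coeff j (hs c (PowerSeries.coeff i (hs a u))) := by
  induction u using ExteriorAlgebra.induction with
  | algebraMap r =>
    intro i j
    rw [hs_algebraMap, hs_algebraMap]
    split_ifs with h1 h2 h2 <;> simp only [hs_algebraMap, h1, h2, map_zero, if_true, if_false]
  | ι x => intro i j; rw [hs_ι, hs_ι, hs_ι, hs_ι, hac]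
  | mul u v hu hv =>
    intro i j
    simp only [hs_mul, map_sum]
    rw [Finset.sum_comm]
    simp only [hu, hv]
  | add u v hu hv => intro i j; simp only [map_add, hu, hv]

theorem sum_bb_comm (m : ℤ) (i d : ℕ) :
    ∑ q ∈ antidiagonal i, bb (m + (i + d : ℕ) + q.1) * bb (m - 1 + q.2) =
      ∑ q ∈ antidiagonal (i + d), bb (m + i + q.1) * bb (m - 1 + q.2) := by
  rw [Finset.Nat.sum_antidiagonal_eq_sum_range_succ_mk,
    Finset.Nat.sum_antidiagonal_eq_sum_range_succ_mk]
  have e : (i + d).succ = d + i.succ := by omega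
  rw [e, Finset.sum_range_add]
  have h0 : ∑ k ∈ Finset.range d, bb (m + i + (k : ℤ)) * bb (m - 1 + ((i + d - k : ℕ) : ℤ)) = 0 := by
    cases d with
    | zero => simp
    | succ d =>
      have h := sum_ι_mul_ι (fun k => bvec (m + i + k)) d
      rw [Finset.Nat.sum_antidiagonal_eq_sum_range_succ_mk] at h
      rw [← h]
      refine Finset.sum_congr rfl fun k hk => ?_
      have hk' : k < d + 1 := by simpa using hk
      have e : m - 1 + ((i + (d + 1) - k : ℕ) : ℤ) = m + i + ((d - k : ℕ) : ℤ) := by omega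
      simp only [e, bb]
  simp only at h0 ⊢
  rw [h0, zero_add]
  refine Finset.sum_congr rfl fun k hk => ?_
  have e1 : m + ((i + d : ℕ) : ℤ) + k = m + i + ((d + k : ℕ) : ℤ) := by push_cast; ring
  have e2 : i + d - (d + k) = i - k := by omega
  rw [e1, e2]

theorem sigmaPlusN_vac (n : ℕ) (u : Ext) (m : ℤ) :
    sigmaPlusN n (wedgeVac u m) = ∑ p ∈ antidiagonal n,
      wedgeVac (PowerSeries.coeff p.1 (hs (schubSeq 1) u) * bb (m + p.2)) (m - 1) := by
  rw [sigmaPlusN, hsExt_wedgeVac]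
  simp only [phiPlus, smul_wedgeVac]

theorem sigmaPlusN_comm_vac (i j : ℕ) (m : ℤ) :
    sigmaPlusN i (sigmaPlusN j (wedgeVac 1 m)) = sigmaPlusN j (sigmaPlusN i (wedgeVac 1 m)) := by
  have hone : ∀ n : ℕ, sigmaPlusN n (wedgeVac 1 m) = wedgeVac (bb (m + n)) (m - 1) := by
    intro n
    have h := hsExt_wedgeVac (schubSeq 1) phiPlus plus_h1 plus_h2 n (bb (m + 1 - 1)) (m - 1)
    have h1 := plus_h1 n m
    rw [sigmaPlusN, ← one_mul (1 : Ext), ← wedgeVac_bb_sub_one, one_mul, one_mul]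
    rw [hsExt, fockLift_wedgeVac, h1, phiPlus]
  have h2 : ∀ i j : ℕ, sigmaPlusN i (sigmaPlusN j (wedgeVac 1 m)) =
      wedgeVac (∑ q ∈ antidiagonal i, bb (m + j + q.1) * bb (m - 1 + q.2)) (m - 1 - 1) := by
    intro i j
    rw [hone, sigmaPlusN_vac]
    simp only [bb, hs_ι]
    simp only [schubSeq_ι, one_mul]
    exact (map_sum (AddMonoidHom.mk' (fun t => wedgeVac t (m - 1 - 1))
      (fun x y => wedgeVac_add x y _)) _ _).symm
  rw [h2, h2]
  congr 1
  rcases le_total i j with h | h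
  · obtain ⟨d, rfl⟩ := Nat.exists_eq_add_of_le h
    exact sum_bb_comm m i d
  · obtain ⟨d, rfl⟩ := Nat.exists_eq_add_of_le h
    exact (sum_bb_comm m j d).symm

theorem sigmaPlusN_comm (i j : ℕ) : sigmaPlusN i * sigmaPlusN j = sigmaPlusN j * sigmaPlusN i := by
  have hsm : ∀ (n : ℕ) (u : Ext) (x : Fock), sigmaPlusN n (u • x) = ∑ p ∈ antidiagonal n,
      PowerSeries.coeff p.1 (hs (schubSeq 1) u) • sigmaPlusN p.2 x :=
    fun n u x => hsExt_smul _ _ _ _ n u x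
  refine LinearMap.ext fun x => ?_
  simp only [Module.End.mul_apply]
  induction x using fock_induction with
  | hadd x y hx hy => simp only [map_add, hx, hy]
  | hp u m =>
    rw [← mul_one u, ← smul_wedgeVac]
    simp only [hsm, map_sum]
    rw [Finset.sum_comm]
    refine Finset.sum_congr rfl fun p _ => Finset.sum_congr rfl fun q _ => ?_
    rw [hs_comm (schubSeq 1) (schubSeq 1) (fun i j x => shift_comm _ _ x), sigmaPlusN_comm_vac]

theorem sigmaPlusN_zero : sigmaPlusN 0 = 1 := by
  refine LinearMap.ext fun x => ?_
  induction x using fock_induction with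
  | hadd x y hx hy => simp only [map_add, hx, hy]
  | hp u m =>
    rw [sigmaPlusN_vac, Finset.HasAntidiagonal.antidiagonal_zero, Finset.sum_singleton,
      hs_coeff_zero _ (fun x => by simp only [schubSeq, shift, Nat.cast_zero, mul_zero, add_zero]; exact Finsupp.mapDomain_id)]
    simpa using wedgeVac_bb_sub_one u m

/-- The ring `B = ℤ[e_1, e_2, …]`, where `e_{i+1}` is the variable with index `i`. -/
abbrev BRing : Type := MvPolynomial ℕ ℤ

/-- `E(z) = 1 + ∑_{j ≥ 1} (-1)^j e_j z^j`. -/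
def Eser : PowerSeries BRing :=
  PowerSeries.mk fun n => match n with
    | 0 => 1
    | k + 1 => (-1) ^ (k + 1) * MvPolynomial.X k

/-- `H(z) = ∑ h_j z^j = 1 / E(z)`. -/
def Hser : PowerSeries BRing := PowerSeries.invOfUnit Eser 1

/-- The commutative subring of `End(F)` generated by the coefficients of `σ_+(z)`. -/
def sigmaRing : Subring (Module.End ℤ Fock) := Subring.closure (Set.range sigmaPlusN)

instance : IsMulCommutative sigmaRing :=
  Subring.isMulCommutative_closure (by
    rintro _ ⟨i, rfl⟩ _ ⟨j, rfl⟩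
    exact sigmaPlusN_comm i j)

instance : CommRing sigmaRing where
  mul_comm a b := IsMulCommutative.is_comm.comm a b

/-- The series `σ_+(z)` with coefficients in the commutative ring generated by them. -/
def sigmaSer : PowerSeries sigmaRing :=
  PowerSeries.mk fun n => ⟨sigmaPlusN n, Subring.subset_closure ⟨n, rfl⟩⟩

/-- The ring homomorphism `B → End(F)` with `h_i ↦ σ_i`, i.e. `E(z) ↦ 1 / σ_+(z)`. -/
def bosonHom : BRing →+* sigmaRing :=
  MvPolynomial.eval₂Hom (Int.castRingHom sigmaRing)
    fun k => (-1) ^ (k + 1) * PowerSeries.coeff (k + 1) (PowerSeries.invOfUnit sigmaSer 1)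

/-- The `B`-module structure of `F`, determined by `h_i u = σ_i(u)`. -/
instance : Module BRing Fock :=
  Module.compHom Fock (sigmaRing.subtype.comp bosonHom)

theorem Hser_smul (n : ℕ) (x : Fock) : PowerSeries.coeff n Hser • x = sigmaPlusN n x := by
  have hS : PowerSeries.constantCoeff sigmaSer = ((1 : sigmaRingˣ) : sigmaRing) := by
    rw [← PowerSeries.coeff_zero_eq_constantCoeff_apply, sigmaSer, PowerSeries.coeff_mk]
    exact Subtype.ext sigmaPlusN_zero
  have hE : PowerSeries.constantCoeff Eser = ((1 : BRingˣ) : BRing) := by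
    rw [← PowerSeries.coeff_zero_eq_constantCoeff_apply, Eser, PowerSeries.coeff_mk]
    rfl
  have h1 : PowerSeries.map bosonHom Eser = PowerSeries.invOfUnit sigmaSer 1 := by
    ext n : 1
    rw [PowerSeries.coeff_map, Eser, PowerSeries.coeff_mk]
    cases n with
    | zero =>
      rw [PowerSeries.coeff_zero_eq_constantCoeff_apply, PowerSeries.constantCoeff_invOfUnit]
      simp
    | succ k =>
      simp only [map_mul, map_pow, map_neg, map_one, bosonHom, MvPolynomial.coe_eval₂Hom,
        MvPolynomial.eval₂_X]
      rw [← mul_assoc, ← mul_pow]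
      simp
  have h2 : PowerSeries.map bosonHom Hser = sigmaSer := by
    have h3 : PowerSeries.map bosonHom Eser * PowerSeries.map bosonHom Hser = 1 := by
      rw [← map_mul, Hser, PowerSeries.mul_invOfUnit _ _ hE, map_one]
    rw [h1] at h3
    calc PowerSeries.map bosonHom Hser
        = sigmaSer * PowerSeries.invOfUnit sigmaSer 1 * PowerSeries.map bosonHom Hser := by
          rw [PowerSeries.mul_invOfUnit _ _ hS, one_mul]
      _ = sigmaSer := by rw [mul_assoc, h3, mul_one]
  have h4 : bosonHom (PowerSeries.coeff n Hser) =
      ⟨sigmaPlusN n, Subring.subset_closure ⟨n, rfl⟩⟩ := by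
    rw [← PowerSeries.coeff_map, h2, sigmaSer, PowerSeries.coeff_mk]
  change (bosonHom (PowerSeries.coeff n Hser) : Module.End ℤ Fock) x = _
  rw [h4]

/-! ### Formal distributions in two variables -/

/-- Formal series `∑ f_{ij} z^i w^j` in `V[[z^{±1}, w^{±1}]]`; `f i j` is the coefficient of
`z^i w^j`. -/
abbrev FormalDist (V : Type) : Type := ℤ → ℤ → V

/-- The constant series `v`. -/
def constDist (v : Fock) : FormalDist Fock := fun i j => if i = 0 ∧ j = 0 then v else 0

/-- `A(z) f(z,w)` for an operator series `A(z) = ∑ A_n z^n`; a coefficient is meaningful when its sum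
has only finitely many non-zero terms, see `DefinedZ`. -/
def applyZ (A : ℤ → Module.End ℤ Fock) (f : FormalDist Fock) : FormalDist Fock :=
  fun i j => ∑ᶠ n : ℤ, A n (f (i - n) j)

/-- `A(w) f(z,w)` for an operator series `A(w) = ∑ A_n w^n`. -/
def applyW (A : ℤ → Module.End ℤ Fock) (f : FormalDist Fock) : FormalDist Fock :=
  fun i j => ∑ᶠ n : ℤ, A n (f i (j - n))

/-- The product `c(z,w) f(z,w)` with a series of scalars. -/
def mulDist {R : Type} [SMul R Fock] (c : FormalDist R) (f : FormalDist Fock) : FormalDist Fock :=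
  fun i j => ∑ᶠ p : ℤ × ℤ, c p.1 p.2 • f (i - p.1) (j - p.2)

/-- Every coefficient of `A(z) f(z,w)` is a finite sum. -/
def DefinedZ (A : ℤ → Module.End ℤ Fock) (f : FormalDist Fock) : Prop :=
  ∀ i j : ℤ, {n : ℤ | A n (f (i - n) j) ≠ 0}.Finite

/-- Every coefficient of `A(w) f(z,w)` is a finite sum. -/
def DefinedW (A : ℤ → Module.End ℤ Fock) (f : FormalDist Fock) : Prop :=
  ∀ i j : ℤ, {n : ℤ | A n (f i (j - n)) ≠ 0}.Finite

/-- Every coefficient of `c(z,w) f(z,w)` is a finite sum. -/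
def DefinedMul {R : Type} [SMul R Fock] (c : FormalDist R) (f : FormalDist Fock) : Prop :=
  ∀ i j : ℤ, {p : ℤ × ℤ | c p.1 p.2 • f (i - p.1) (j - p.2) ≠ 0}.Finite

/-- The Laurent monomial `z^m / w^m`. -/
def zwPow (m : ℤ) : FormalDist ℤ := fun i j => if i = m ∧ j = -m then 1 else 0

/-- `i_{z,w} (z / (z - w)) = ∑_{k ≥ 0} (w/z)^k`. -/
def iotaZW : FormalDist ℤ := fun i j => if 0 ≤ j ∧ i = -j then 1 else 0

/-- `(1 - w/z) * i_{z,w} (z / (z - w)) = 1`, coefficient by coefficient. -/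
theorem iotaZW_spec (i j : ℤ) :
    iotaZW i j - iotaZW (i + 1) (j - 1) = if i = 0 ∧ j = 0 then 1 else 0 := by
  simp only [iotaZW]
  split_ifs <;> omega

/-- The series `E(w) / E(z) = E(w) H(z)` in `B[[z, w]]`. -/
def EwDivEz : FormalDist BRing := fun i j =>
  posCoeff (fun n => PowerSeries.coeff n Hser) i * posCoeff (fun n => PowerSeries.coeff n Eser) j

/-- `δ(z,w) v = ∑ δ(B_{ij}) v z^i w^{-j}`. -/
def deltaSeries (v : Fock) : FormalDist Fock := fun i j => deltaFock (elemMat i (-j)) v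

end DJKM

end

open scoped TensorProduct

noncomputable section

namespace DJKM

/-! ### Left multiplication by basis vectors -/

/-! Write `S` for `fockShift 1`, which raises every index, including that of the vacuum, by one. On
charge `m`, the product `σ_+(z) σ̄_-(z)` is a creation field: its coefficient at `z^i` is `x ↦
b_{m+i} ∧ S⁻¹ x` (`HasCharge.creatCoeff_eq`). Indeed `σ_+(z)(b_k - b_{k-1} z⁻¹) = -b_{k-1} z⁻¹`, so
each factor `b_k` is merely lowered with a sign, and the sign records the passage of `b(z)` past it.
The product `σ̄_+(w) σ_-(w)` is an annihilation field: its coefficients `A_j` satisfy `A_j(b_k ∧ x)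
= [j = m+1-k] S x - b_{k+1} ∧ A_{j-1} x` (`HasCharge.annihCoeff_bb_smul`), the rule of a contraction
followed by `S`.

Hence `T = b_i ∧ S⁻¹ A_{m-j}` obeys `T(b_k ∧ x) = [k = j] b_i ∧ x + b_k ∧ T x`, with the charge in
`T` adjusted. This is the Leibniz rule of `δ(B_{ij})`, and both operators kill `[b]_m` for `m < j`.
They therefore agree (`HasCharge.deltaFock_elemMat`), which is the first formula; invariance of
`F_m` follows, because `T` preserves the charge.

The second formula comes from `(1 - w/z) σ̄_-(z) σ̄_+(w) = σ̄_+(w) σ̄_-(z)`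
(`sigmaBarMinus_sigmaBarPlus`), whose scalar factor arises on the vacuum only; dividing by `1 - w/z`
is legitimate because the powers of `w` are bounded below. In the third, `1/E(z)` acts as `σ_+(z)`
by construction, and `E(w)` as `σ̄_+(w)` because `σ̄_+` inverts `σ_+` (`Eser_smul`). -/

/-- The vacuum vector `[b]_m`. -/
def vac (m : ℤ) : Fock := wedgeVac 1 m

theorem wedgeVac_eq_smul_vac (u : Ext) (m : ℤ) : wedgeVac u m = u • vac m := by
  rw [vac, smul_wedgeVac, mul_one]

theorem bb_smul_vac_sub_one (m : ℤ) : bb m • vac (m - 1) = vac m := by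
  rw [← wedgeVac_eq_smul_vac, vac]
  simpa using wedgeVac_bb_sub_one 1 m

theorem bb_smul_vac_of_le {k m : ℤ} (h : k ≤ m) : bb k • vac m = 0 := by
  rw [← wedgeVac_eq_smul_vac]
  simpa using wedgeVac_bb_le 1 h

theorem bb_smul_bb_smul (k l : ℤ) (x : Fock) : bb k • bb l • x = -(bb l • bb k • x) := by
  rw [smul_smul, smul_smul, bb_mul_bb, neg_smul]

theorem bb_smul_self (k : ℤ) (x : Fock) : bb k • bb k • x = 0 := by
  rw [smul_smul, bb_mul_self, zero_smul]

/-- A property of elements of `F` that is stable under sums, integer multiples and left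
multiplication by the `b_k`, and holds for all `[b]_m`, holds everywhere. -/
theorem fock_wedge_induction {p : Fock → Prop} (hvac : ∀ m, p (vac m))
    (hbb : ∀ k x, p x → p (bb k • x)) (hadd : ∀ x y, p x → p y → p (x + y))
    (hsmul : ∀ (c : ℤ) x, p x → p (c • x)) (x : Fock) : p x := by
  have h0 : p 0 := by simpa using hsmul 0 _ (hvac 0)
  have hι : ∀ (y : FreeM) (x : Fock), p x → p (ExteriorAlgebra.ι ℤ y • x) := by
    intro y x hx
    induction y using Finsupp.induction_linear with
    | zero => simpa using h0
    | add f g hf hg => rw [map_add, add_smul]; exact hadd _ _ hf hg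
    | single k c =>
      have : (Finsupp.single k c : FreeM) = c • bvec k := by simp [bvec]
      rw [this, map_smul, smul_assoc]
      exact hsmul _ _ (hbb k x hx)
  induction x using fock_induction with
  | hadd x y hx hy => exact hadd _ _ hx hy
  | hp u m =>
    rw [wedgeVac_eq_smul_vac]
    -- The exterior algebra is the Clifford algebra of the form `0`; this induction peels one vector
    -- off on the left.
    refine CliffordAlgebra.left_induction (P := fun u => p (u • vac m)) 0 ?_ ?_ ?_ u
    · intro r
      rw [algebraMap_smul]
      exact hsmul _ _ (hvac m)
    · intro u v hu hv
      rw [add_smul]; exact hadd _ _ hu hv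
    · intro u y hu
      rw [mul_smul]
      exact hι y _ hu

/-- An element uses finitely many vacua, and a low enough `b_k` is already contained in each of
them. This supplies the starting point for inductions on `k` from far below. -/
theorem exists_bb_smul_eq_zero (x : Fock) : ∃ N : ℤ, ∀ k < N, bb k • x = 0 := by
  induction x using fock_wedge_induction with
  | hvac m => exact ⟨m, fun k hk => bb_smul_vac_of_le hk.le⟩
  | hbb l x ih =>
    obtain ⟨N, hN⟩ := ih
    exact ⟨N, fun k hk => by rw [bb_smul_bb_smul, hN k hk, smul_zero, neg_zero]⟩
  | hadd x y hx hy =>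
    obtain ⟨N, hN⟩ := hx
    obtain ⟨N', hN'⟩ := hy
    exact ⟨min N N', fun k hk => by
      rw [smul_add, hN k (by omega), hN' k (by omega), add_zero]⟩
  | hsmul c x ih =>
    obtain ⟨N, hN⟩ := ih
    exact ⟨N, fun k hk => by rw [smul_comm, hN k hk, smul_zero]⟩

/-! ### Recursions for the Schubert derivations -/

/-- The geometric series satisfies `σ(z) b_k = b_k + z σ(z) b_{k+e}`, which replaces a sum of
growing length by a shift of `k`. -/
theorem hsExt_schubSeq_bb_smul_succ (e : ℤ) (φ : ℤ → ℕ → Fock) (h1) (h2) (n : ℕ) (k : ℤ)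
    (x : Fock) :
    hsExt (schubSeq e) φ h1 h2 (n + 1) (bb k • x) =
      hsExt (schubSeq e) φ h1 h2 n (bb (k + e) • x) +
        bb k • hsExt (schubSeq e) φ h1 h2 (n + 1) x := by
  rw [hsExt_smul, hsExt_smul, Finset.Nat.sum_antidiagonal_succ, add_comm]
  simp only [bb, hs_ι]
  simp only [schubSeq_ι]
  refine congrArg₂ (· + ·) (Finset.sum_congr rfl fun p _ => ?_) (by simp [bb])
  congr 2
  push_cast
  ring

theorem hsExt_schubSeq_bb_smul_zero (e : ℤ) (φ : ℤ → ℕ → Fock) (h1) (h2) (k : ℤ) (x : Fock) :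
    hsExt (schubSeq e) φ h1 h2 0 (bb k • x) = bb k • hsExt (schubSeq e) φ h1 h2 0 x := by
  rw [hsExt_smul]
  simp only [bb, hs_ι]
  simp [schubSeq_ι, bb]

theorem hsExt_schubBarSeq_bb_smul_zero (e : ℤ) (φ : ℤ → ℕ → Fock) (h1) (h2) (k : ℤ) (x : Fock) :
    hsExt (schubBarSeq e) φ h1 h2 0 (bb k • x) = bb k • hsExt (schubBarSeq e) φ h1 h2 0 x := by
  rw [hsExt_smul]
  simp [bb, hs_ι, schubBarSeq, linSeq]

theorem hsExt_schubBarSeq_bb_smul_succ (e : ℤ) (φ : ℤ → ℕ → Fock) (h1) (h2) (n : ℕ) (k : ℤ)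
    (x : Fock) :
    hsExt (schubBarSeq e) φ h1 h2 (n + 1) (bb k • x) =
      bb k • hsExt (schubBarSeq e) φ h1 h2 (n + 1) x -
        bb (k + e) • hsExt (schubBarSeq e) φ h1 h2 n x := by
  rw [hsExt_smul, Finset.Nat.sum_antidiagonal_succ]
  simp only [bb, hs_ι]
  cases n with
  | zero => simp [schubBarSeq, linSeq, sub_eq_add_neg]
  | succ n =>
    rw [Finset.Nat.sum_antidiagonal_succ]
    simp [schubBarSeq, linSeq, sub_eq_add_neg]

theorem posCoeff_natCast {A : Type*} [Zero A] (f : ℕ → A) (n : ℕ) : posCoeff f n = f n := by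
  simp [posCoeff]

theorem posCoeff_of_neg {A : Type*} [Zero A] (f : ℕ → A) {n : ℤ} (h : n < 0) :
    posCoeff f n = 0 := by
  simp [posCoeff, h]

theorem sigmaPlus_of_neg {n : ℤ} (h : n < 0) : sigmaPlus n = 0 := posCoeff_of_neg _ h

theorem sigmaBarPlus_of_neg {n : ℤ} (h : n < 0) : sigmaBarPlus n = 0 := posCoeff_of_neg _ h

theorem sigmaMinus_of_pos {n : ℤ} (h : 0 < n) : sigmaMinus n = 0 := posCoeff_of_neg _ (by omega)

theorem sigmaBarMinus_of_pos {n : ℤ} (h : 0 < n) : sigmaBarMinus n = 0 :=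
  posCoeff_of_neg _ (by omega)

theorem posCoeff_bb_smul (e : ℤ) (φ : ℤ → ℕ → Fock) (h1) (h2) (n k : ℤ) (x : Fock) :
    posCoeff (hsExt (schubSeq e) φ h1 h2) n (bb k • x) =
      posCoeff (hsExt (schubSeq e) φ h1 h2) (n - 1) (bb (k + e) • x) +
        bb k • posCoeff (hsExt (schubSeq e) φ h1 h2) n x := by
  rcases lt_trichotomy n 0 with h | rfl | h
  · simp [posCoeff_of_neg _ h, posCoeff_of_neg _ (show n - 1 < 0 by omega)]
  · rw [posCoeff_of_neg _ (show (0 : ℤ) - 1 < 0 by omega)]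
    simpa [posCoeff] using hsExt_schubSeq_bb_smul_zero e φ h1 h2 k x
  · obtain ⟨j, rfl⟩ : ∃ j : ℕ, n = (j + 1 : ℕ) := ⟨(n - 1).toNat, by omega⟩
    rw [show ((j + 1 : ℕ) : ℤ) - 1 = j by push_cast; ring]
    simp only [posCoeff_natCast]
    exact hsExt_schubSeq_bb_smul_succ e φ h1 h2 j k x

theorem posCoeff_bar_bb_smul (e : ℤ) (φ : ℤ → ℕ → Fock) (h1) (h2) (n k : ℤ) (x : Fock) :
    posCoeff (hsExt (schubBarSeq e) φ h1 h2) n (bb k • x) =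
      bb k • posCoeff (hsExt (schubBarSeq e) φ h1 h2) n x -
        bb (k + e) • posCoeff (hsExt (schubBarSeq e) φ h1 h2) (n - 1) x := by
  rcases lt_trichotomy n 0 with h | rfl | h
  · simp [posCoeff_of_neg _ h, posCoeff_of_neg _ (show n - 1 < 0 by omega)]
  · rw [posCoeff_of_neg _ (show (0 : ℤ) - 1 < 0 by omega)]
    simpa [posCoeff] using hsExt_schubBarSeq_bb_smul_zero e φ h1 h2 k x
  · obtain ⟨j, rfl⟩ : ∃ j : ℕ, n = (j + 1 : ℕ) := ⟨(n - 1).toNat, by omega⟩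
    rw [show ((j + 1 : ℕ) : ℤ) - 1 = j by push_cast; ring]
    simp only [posCoeff_natCast]
    exact hsExt_schubBarSeq_bb_smul_succ e φ h1 h2 j k x

theorem sigmaPlus_bb_smul (n k : ℤ) (x : Fock) :
    sigmaPlus n (bb k • x) = sigmaPlus (n - 1) (bb (k + 1) • x) + bb k • sigmaPlus n x :=
  posCoeff_bb_smul 1 _ _ _ n k x

theorem sigmaBarPlus_bb_smul (n k : ℤ) (x : Fock) :
    sigmaBarPlus n (bb k • x) = bb k • sigmaBarPlus n x - bb (k + 1) • sigmaBarPlus (n - 1) x :=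
  posCoeff_bar_bb_smul 1 _ _ _ n k x

theorem sigmaMinus_bb_smul (n k : ℤ) (x : Fock) :
    sigmaMinus n (bb k • x) = sigmaMinus (n + 1) (bb (k - 1) • x) + bb k • sigmaMinus n x := by
  have h := posCoeff_bb_smul (-1) phiMinus minus_h1 minus_h2 (-n) k x
  rwa [show -n - 1 = -(n + 1) by ring] at h

theorem sigmaBarMinus_bb_smul (n k : ℤ) (x : Fock) :
    sigmaBarMinus n (bb k • x) =
      bb k • sigmaBarMinus n x - bb (k - 1) • sigmaBarMinus (n + 1) x := by
  have h := posCoeff_bar_bb_smul (-1) phiMinus barMinus_h1 barMinus_h2 (-n) k x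
  rwa [show -n - 1 = -(n + 1) by ring] at h

theorem hsExt_vac (a : ℕ → FreeM →ₗ[ℤ] FreeM) (φ : ℤ → ℕ → Fock) (h1) (h2) (n : ℕ) (m : ℤ) :
    hsExt a φ h1 h2 n (vac m) = φ m n := by
  rw [← bb_smul_vac_sub_one, ← h1, vac, smul_wedgeVac, mul_one, hsExt, fockLift_wedgeVac]

theorem sigmaPlus_vac (n m : ℤ) : sigmaPlus n (vac m) = bb (m + n) • vac (m - 1) := by
  rcases lt_or_ge n 0 with h | h
  · rw [sigmaPlus_of_neg h, bb_smul_vac_of_le (by omega), LinearMap.zero_apply]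
  · lift n to ℕ using h
    rw [sigmaPlus, posCoeff_natCast, sigmaPlusN, hsExt_vac, phiPlus, wedgeVac_eq_smul_vac]

theorem sigmaBarPlus_vac (n : ℕ) (m : ℤ) : sigmaBarPlus n (vac m) = phiBarPlus m n := by
  rw [sigmaBarPlus, posCoeff_natCast, hsExt_vac]

theorem sigmaMinus_vac (n m : ℤ) : sigmaMinus n (vac m) = if n = 0 then vac m else 0 := by
  rcases lt_or_ge 0 n with h | h
  · rw [sigmaMinus_of_pos h, if_neg h.ne', LinearMap.zero_apply]
  · obtain ⟨j, rfl⟩ : ∃ j : ℕ, n = -j := ⟨(-n).toNat, by omega⟩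
    rw [sigmaMinus, neg_neg, posCoeff_natCast, hsExt_vac, phiMinus]
    simp [vac]

theorem sigmaBarMinus_vac (n m : ℤ) : sigmaBarMinus n (vac m) = if n = 0 then vac m else 0 := by
  rcases lt_or_ge 0 n with h | h
  · rw [sigmaBarMinus_of_pos h, if_neg h.ne', LinearMap.zero_apply]
  · obtain ⟨j, rfl⟩ : ∃ j : ℕ, n = -j := ⟨(-n).toNat, by omega⟩
    rw [sigmaBarMinus, neg_neg, posCoeff_natCast, hsExt_vac, phiMinus]
    simp [vac]

/-! ### Local finiteness of `σ̄_-` and `σ_-` -/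

theorem exists_sigmaBarMinus_eq_zero (x : Fock) :
    ∃ N : ℤ, ∀ n < N, sigmaBarMinus n x = 0 := by
  induction x using fock_wedge_induction with
  | hvac m => exact ⟨0, fun n hn => by rw [sigmaBarMinus_vac, if_neg hn.ne]⟩
  | hbb k x ih =>
    obtain ⟨N, hN⟩ := ih
    exact ⟨N - 1, fun n hn => by
      rw [sigmaBarMinus_bb_smul, hN n (by omega), hN (n + 1) (by omega)]; simp⟩
  | hadd x y hx hy =>
    obtain ⟨N, hN⟩ := hx
    obtain ⟨N', hN'⟩ := hy
    exact ⟨min N N', fun n hn => by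
      rw [map_add, hN n (by omega), hN' n (by omega), add_zero]⟩
  | hsmul c x ih =>
    obtain ⟨N, hN⟩ := ih
    exact ⟨N, fun n hn => by rw [map_smul, hN n hn, smul_zero]⟩

theorem exists_common_bound {q : ℤ → ℤ → Prop} (h : ∀ j, ∃ N : ℤ, ∀ k < N, q j k) (a b : ℤ) :
    ∃ N : ℤ, ∀ j, a ≤ j → j ≤ b → ∀ k < N, q j k := by
  choose N hN using h
  obtain ⟨B, hB⟩ := ((Set.finite_Icc a b).image N).bddBelow
  exact ⟨B, fun j h1 h2 k hk => hN j k (hk.trans_le (hB ⟨j, ⟨h1, h2⟩, rfl⟩))⟩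

theorem sigmaMinus_bb_smul_eq_add (n k : ℤ) (x : Fock) (t : ℕ) :
    sigmaMinus n (bb k • x) = sigmaMinus (n + t) (bb (k - t) • x) +
      ∑ i ∈ Finset.range t, bb (k - i) • sigmaMinus (n + i) x := by
  induction t with
  | zero => simp
  | succ t ih =>
    rw [ih, Finset.sum_range_succ, sigmaMinus_bb_smul (n + t)]
    push_cast
    rw [show n + (t : ℤ) + 1 = n + (t + 1) by ring, show k - (t : ℤ) - 1 = k - (t + 1) by ring]
    abel

/-- Here `σ_-(z) b_k` is an infinite series, so degrees alone do not suffice. But only the finitely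
many `σ_j x` with `N ≤ j ≤ 0` can be nonzero, and a common bound `K` exists below which every `b_l`
kills all of them. -/
theorem exists_sigmaMinus_eq_zero (x : Fock) :
    ∃ N : ℤ, ∀ n < N, sigmaMinus n x = 0 := by
  induction x using fock_wedge_induction with
  | hvac m => exact ⟨0, fun n hn => by rw [sigmaMinus_vac, if_neg hn.ne]⟩
  | hbb k x ih =>
    obtain ⟨N, hN⟩ := ih
    obtain ⟨K, hK⟩ := exists_common_bound (fun j => exists_bb_smul_eq_zero (sigmaMinus j x)) N 0
    refine ⟨min (min N 0) (N - k + K), fun n hn => ?_⟩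
    -- The choice `t = 1 - n` gives `n + t = 1`, a degree in which `σ_-` has no coefficient; only
    -- the sum remains.
    rw [sigmaMinus_bb_smul_eq_add n k x (1 - n).toNat, sigmaMinus_of_pos (by omega),
      LinearMap.zero_apply, zero_add]
    refine Finset.sum_eq_zero fun i hi => ?_
    rw [Finset.mem_range] at hi
    rcases lt_or_ge (n + i) N with h | h
    · rw [hN _ h, smul_zero]
    · exact hK (n + i) h (by omega) _ (by omega)
  | hadd x y hx hy =>
    obtain ⟨N, hN⟩ := hx
    obtain ⟨N', hN'⟩ := hy
    exact ⟨min N N', fun n hn => by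
      rw [map_add, hN n (by omega), hN' n (by omega), add_zero]⟩
  | hsmul c x ih =>
    obtain ⟨N, hN⟩ := ih
    exact ⟨N, fun n hn => by rw [map_smul, hN n hn, smul_zero]⟩

/-! ### The vectors `σ̄_+(z)[b]_m` -/

theorem phiBarPlus_zero (m : ℤ) : phiBarPlus m 0 = vac m := by
  simp [phiBarPlus, fockBasis, vac]

theorem phiBarPlus_succ (m : ℤ) (n : ℕ) :
    phiBarPlus m (n + 1) = -(bb (m + 1) • phiBarPlus (m - 1) n) := by
  simp only [phiBarPlus, fockBasis]
  rw [bPart_const_succ, smul_comm (bb _), smul_wedgeVac, pow_succ, mul_neg_one, neg_smul]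
  congr 3
  push_cast
  ring

/-- Up to sign, `phiBarPlus m n` is the vacuum `[b]_{m+1}` with `b_{m+1-n}` removed. Wedging with
`b_k` gives zero unless it fills that hole, and the sign `(-1)^n` is the cost of moving it past the
`n` larger factors. -/
theorem bb_smul_phiBarPlus (n : ℕ) {k m : ℤ} (h : k ≤ m + 1) :
    bb k • phiBarPlus m n = if k = m + 1 - n then vac (m + 1) else 0 := by
  induction n generalizing m with
  | zero =>
    rw [phiBarPlus_zero]
    split_ifs with hk
    · have := bb_smul_vac_sub_one (m + 1)
      rw [add_sub_cancel_right] at this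
      rw [← this, hk]; simp
    · exact bb_smul_vac_of_le (by simp at hk; omega)
  | succ n ih =>
    rw [phiBarPlus_succ, smul_neg]
    rcases eq_or_lt_of_le h with rfl | h'
    · rw [bb_smul_self, neg_zero, if_neg (by push_cast; omega)]
    · rw [bb_smul_bb_smul, neg_neg, ih (by omega)]
      have e : (k = m - 1 + 1 - n) ↔ (k = m + 1 - ((n + 1 : ℕ) : ℤ)) := by push_cast; omega
      simp only [e]
      split_ifs
      · have := bb_smul_vac_sub_one (m + 1)
        rw [add_sub_cancel_right] at this
        rw [← this]; simp
      · simp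

/-! ### Charge -/

/-- `x` is an integer combination of vectors `b_{k_1} ∧ ⋯ ∧ b_{k_r} ∧ [b]_{m-r}`. -/
inductive HasCharge : ℤ → Fock → Prop
  | vac (m : ℤ) : HasCharge m (vac m)
  | wedge (k : ℤ) {m : ℤ} {x : Fock} : HasCharge m x → HasCharge (m + 1) (bb k • x)
  | add {m : ℤ} {x y : Fock} : HasCharge m x → HasCharge m y → HasCharge m (x + y)
  | smul (c : ℤ) {m : ℤ} {x : Fock} : HasCharge m x → HasCharge m (c • x)

theorem HasCharge.zero (m : ℤ) : HasCharge m 0 := by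
  simpa using HasCharge.smul 0 (HasCharge.vac m)

theorem HasCharge.neg {m : ℤ} {x : Fock} (h : HasCharge m x) : HasCharge m (-x) := by
  simpa using HasCharge.smul (-1) h

theorem HasCharge.sub {m : ℤ} {x y : Fock} (hx : HasCharge m x) (hy : HasCharge m y) :
    HasCharge m (x - y) := by
  simpa [sub_eq_add_neg] using hx.add hy.neg

theorem HasCharge.word (l : List ℤ) (n : ℤ) :
    HasCharge (n + l.length) ((l.map bb).prod • DJKM.vac n) := by
  induction l with
  | nil => simpa using HasCharge.vac n
  | cons k l ih =>
    rw [List.map_cons, List.prod_cons, mul_smul]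
    simpa [add_assoc] using HasCharge.wedge k ih

theorem fockBasis_eq_word (m : ℤ) {r : ℕ} (lam : Fin r → ℕ) :
    fockBasis m lam =
      ((List.ofFn fun i : Fin r => m - (i : ℕ) + lam i).map bb).prod • vac (m - r) := by
  rw [fockBasis, wedgeVac_eq_smul_vac, bPart, List.map_ofFn]
  rfl

theorem hasCharge_fockBasis (m : ℤ) {r : ℕ} (lam : Fin r → ℕ) :
    HasCharge m (fockBasis m lam) := by
  rw [fockBasis_eq_word]
  simpa using HasCharge.word (List.ofFn fun i : Fin r => m - (i : ℕ) + lam i) (m - r)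

theorem hasCharge_of_mem_fockCharge {m : ℤ} {x : Fock} (hx : x ∈ fockCharge m) :
    HasCharge m x := by
  induction hx using Submodule.span_induction with
  | mem x hx =>
    obtain ⟨r, lam, -, rfl⟩ := hx
    exact hasCharge_fockBasis m lam
  | zero => exact HasCharge.zero m
  | add x y _ _ hx hy => exact hx.add hy
  | smul c x _ hx => exact hx.smul c

theorem HasCharge.mem_span_words {m : ℤ} {x : Fock} (h : HasCharge m x) :
    x ∈ Submodule.span ℤ
      (Set.range fun l : List ℤ => (l.map bb).prod • DJKM.vac (m - l.length)) := by
  induction h with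
  | vac m => exact Submodule.subset_span ⟨[], by simp⟩
  | add _ _ hx hy => exact add_mem hx hy
  | smul c _ hx => exact Submodule.smul_mem _ c hx
  | @wedge k m x h hx =>
    clear h
    induction hx using Submodule.span_induction with
    | mem x hx =>
      obtain ⟨l, rfl⟩ := hx
      refine Submodule.subset_span ⟨k :: l, ?_⟩
      simp [mul_smul]
    | zero => simp
    | add x y _ _ hx hy => rw [smul_add]; exact add_mem hx hy
    | smul c x _ hx => rw [smul_comm]; exact Submodule.smul_mem _ c hx

/-! ### Straightening of words into partitions -/

theorem prod_map_bb_perm {l l' : List ℤ} (h : l.Perm l') :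
    (l.map bb).prod = (l'.map bb).prod ∨ (l.map bb).prod = -(l'.map bb).prod := by
  induction h with
  | nil => simp
  | cons k _ ih =>
    rcases ih with h | h
    · left; simp [h]
    · right; simp [h]
  | swap k l t =>
    right
    simp only [List.map_cons, List.prod_cons]
    rw [← mul_assoc, ← mul_assoc, bb_mul_bb, neg_mul]
  | trans _ _ h₁ h₂ =>
    rcases h₁ with h | h <;> rcases h₂ with h' | h' <;> simp [h, h']

theorem pairwise_gt_or_prod_eq_zero {l : List ℤ} (h : l.Pairwise (· ≥ ·)) :
    l.Pairwise (· > ·) ∨ (l.map bb).prod = 0 := by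
  induction l with
  | nil => simp
  | cons k l ih =>
    rw [List.pairwise_cons] at h
    rcases ih h.2 with h' | h'
    · by_cases hk : k ∈ l
      · right
        cases l with
        | nil => simp at hk
        | cons k' l =>
          have : k = k' := by
            rcases List.mem_cons.1 hk with e | e
            · exact e
            · exact absurd (h.1 k' (by simp)) (not_le.2 ((List.pairwise_cons.1 h').1 k e))
          subst this
          simp [← mul_assoc, bb_mul_self]
      · left
        rw [List.pairwise_cons]
        exact ⟨fun x hx => lt_of_le_of_ne (h.1 x hx) (fun e => hk (e ▸ hx)), h'⟩
    · right; simp [h']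

theorem bb_smul_word_of_le {k n : ℤ} (h : k ≤ n) (l : List ℤ) :
    bb k • (l.map bb).prod • vac n = 0 := by
  induction l with
  | nil => simpa using bb_smul_vac_of_le h
  | cons k' l ih =>
    rw [List.map_cons, List.prod_cons, mul_smul, bb_smul_bb_smul, ih, smul_zero, neg_zero]

theorem word_eq_zero_of_mem {k n : ℤ} (h : k ≤ n) {l : List ℤ} (hk : k ∈ l) :
    (l.map bb).prod • vac n = 0 := by
  induction l with
  | nil => simp at hk
  | cons k' l ih =>
    rw [List.map_cons, List.prod_cons, mul_smul]
    rcases List.mem_cons.1 hk with rfl | hk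
    · exact bb_smul_word_of_le h l
    · rw [ih hk, smul_zero]

theorem antitone_getElem_add {l : List ℤ} (h : l.Pairwise (· > ·)) {i j : ℕ} (hij : i ≤ j)
    (hj : j < l.length) : l[j] + j ≤ l[i] + i := by
  induction j, hij using Nat.le_induction with
  | base => exact le_rfl
  | succ j hij ih =>
    have h1 := ih (by omega)
    have h2 : l[j] > l[j + 1] := List.pairwise_iff_getElem.1 h j (j + 1) (by omega) hj (by omega)
    push_cast
    omega

/-- The partition is `λ_i = l_i - (m - i)`. Strictly decreasing integers make `l_i + i` weakly
decreasing, and the lower bound on the letters gives `λ_i ≥ 0`, so `toNat` truncates nothing. -/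
theorem strict_word_mem_fockCharge {l : List ℤ} (h : l.Pairwise (· > ·)) (m : ℤ)
    (hl : ∀ k ∈ l, m - l.length < k) :
    (l.map bb).prod • vac (m - l.length) ∈ fockCharge m := by
  have hlow : ∀ (i : ℕ) (hi : i < l.length), m - i ≤ l[i] := by
    intro i hi
    have h1 := antitone_getElem_add h (i := i) (j := l.length - 1) (by omega) (by omega)
    have h2 := hl (l[l.length - 1]'(by omega)) (List.getElem_mem _)
    omega
  refine Submodule.subset_span
    ⟨l.length, fun i => (l[i] - (m - (i : ℕ))).toNat, fun i j hij => ?_, ?_⟩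
  · have := antitone_getElem_add h (i := i) (j := j) hij j.2
    simp only [Fin.getElem_fin]
    omega
  · rw [fockBasis_eq_word]
    congr 3
    refine List.ext_getElem (by simp) fun i h1 h2 => ?_
    have := hlow i h1
    simp only [List.getElem_ofFn, Fin.getElem_fin]
    omega

/-- Sorting costs only a sign. The sorted word vanishes if a letter is repeated or already lies in
the vacuum; otherwise it is read off as a partition. -/
theorem word_mem_fockCharge (l : List ℤ) (m : ℤ) :
    (l.map bb).prod • vac (m - l.length) ∈ fockCharge m := by
  have hperm := List.perm_insertionSort (· ≥ ·) l
  have hsort : (l.insertionSort (· ≥ ·)).Pairwise (· ≥ ·) := List.pairwise_insertionSort _ l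
  generalize l.insertionSort (· ≥ ·) = s at hperm hsort
  have hs : (s.map bb).prod • vac (m - s.length) ∈ fockCharge m := by
    rcases pairwise_gt_or_prod_eq_zero hsort with h | h
    · by_cases hl : ∀ k ∈ s, m - s.length < k
      · exact strict_word_mem_fockCharge h m hl
      · push Not at hl
        obtain ⟨k, hk, hle⟩ := hl
        rw [word_eq_zero_of_mem hle hk]
        exact zero_mem _
    · rw [h, zero_smul]
      exact zero_mem _
  rw [hperm.length_eq] at hs
  rcases prod_map_bb_perm hperm with h | h
  · rwa [← h]
  · rw [h, neg_smul, neg_mem_iff] at hs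
    exact hs

theorem HasCharge.mem_fockCharge {m : ℤ} {x : Fock} (h : HasCharge m x) : x ∈ fockCharge m := by
  refine (Submodule.span_le.2 ?_) h.mem_span_words
  rintro _ ⟨l, rfl⟩
  exact word_mem_fockCharge l m

/-! ### The charge shift -/

/-- The map `b_{k_1} ∧ ⋯ ∧ b_{k_r} ∧ [b]_m ↦ b_{k_1+e} ∧ ⋯ ∧ b_{k_r+e} ∧ [b]_{m+e}`. -/
def fockShift (e : ℤ) : Module.End ℤ Fock :=
  fockLift
    (fun m => AddMonoidHom.toIntLinearMap
      { toFun := fun u => wedgeVac (ExteriorAlgebra.map (shift e) u) (m + e)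
        map_zero' := by simp [wedgeVac_zero]
        map_add' := fun u v => by simp [wedgeVac_add] })
    (fun u m => by
      change wedgeVac (ExteriorAlgebra.map (shift e) (u * bb m)) (m - 1 + e) =
        wedgeVac (ExteriorAlgebra.map (shift e) u) (m + e)
      rw [map_mul, bb, ExteriorAlgebra.map_apply_ι, shift_bvec, ← bb,
        show m - 1 + e = m + e - 1 by ring, wedgeVac_bb_sub_one])
    (fun u m => by
      change wedgeVac (ExteriorAlgebra.map (shift e) (u * bb m)) (m + e) = 0
      rw [map_mul, bb, ExteriorAlgebra.map_apply_ι, shift_bvec, ← bb, wedgeVac_bb_self])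

theorem fockShift_wedgeVac (e : ℤ) (u : Ext) (m : ℤ) :
    fockShift e (wedgeVac u m) = wedgeVac (ExteriorAlgebra.map (shift e) u) (m + e) := by
  rw [fockShift, fockLift_wedgeVac]
  rfl

theorem fockShift_vac (e m : ℤ) : fockShift e (vac m) = vac (m + e) := by
  rw [vac, fockShift_wedgeVac, map_one, vac]

theorem fockShift_bb_smul (e k : ℤ) (x : Fock) :
    fockShift e (bb k • x) = bb (k + e) • fockShift e x := by
  induction x using fock_induction with
  | hadd x y hx hy => simp only [smul_add, map_add, hx, hy]
  | hp u m =>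
    rw [smul_wedgeVac, fockShift_wedgeVac, fockShift_wedgeVac, smul_wedgeVac, map_mul, bb,
      ExteriorAlgebra.map_apply_ι, shift_bvec, ← bb]

theorem fockShift_neg_fockShift (e : ℤ) (x : Fock) : fockShift (-e) (fockShift e x) = x := by
  induction x using fock_wedge_induction with
  | hvac m => simp [fockShift_vac]
  | hbb k x ih => simp [fockShift_bb_smul, ih]
  | hadd x y hx hy => rw [map_add, map_add, hx, hy]
  | hsmul c x ih => rw [map_smul, map_smul, ih]

theorem HasCharge.fockShift {m : ℤ} {x : Fock} (h : HasCharge m x) (e : ℤ) :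
    HasCharge (m + e) (fockShift e x) := by
  induction h with
  | vac m => rw [fockShift_vac]; exact HasCharge.vac _
  | @wedge k m x _ ih =>
    rw [fockShift_bb_smul, add_right_comm]
    exact ih.wedge _
  | add _ _ hx hy => rw [map_add]; exact hx.add hy
  | smul c _ hx => rw [map_smul]; exact hx.smul c

theorem hasCharge_phiBarPlus (m : ℤ) (n : ℕ) : HasCharge m (phiBarPlus m n) :=
  (hasCharge_fockBasis m _).smul _

/-! ### The inverse of `σ_+` and the action of `E(z)` -/

/-- Telescoping: the term `i = N + 1` is `b_{m+n-N-1} ∧ φ̄_{N+1} - b_{m+n-N} ∧ φ̄_N`, where `φ̄_i`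
is `phiBarPlus (m - 1) i`. At `N = n` the surviving factor `b_m` fills the hole only when `n = 0`.
-/
theorem sum_sigmaBarPlus_sigmaPlus_vac (n : ℕ) (m : ℤ) (N : ℕ) :
    ∑ i ∈ Finset.range (N + 1), sigmaBarPlus i (sigmaPlus (n - i) (vac m)) =
      bb (m + n - N) • phiBarPlus (m - 1) N := by
  simp only [sigmaPlus_vac]
  induction N with
  | zero =>
    rw [Finset.sum_range_one, sigmaBarPlus_bb_smul, sigmaBarPlus_of_neg (n := _ - 1) (by simp),
      sigmaBarPlus_vac]
    simp
  | succ N ih =>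
    rw [Finset.sum_range_succ, ih, sigmaBarPlus_bb_smul, sigmaBarPlus_vac,
      show ((N + 1 : ℕ) : ℤ) - 1 = N by push_cast; ring, sigmaBarPlus_vac,
      show m + ((n : ℤ) - ((N + 1 : ℕ) : ℤ)) + 1 = m + n - N by push_cast; ring,
      ← add_sub_assoc m, add_sub_cancel]

theorem sum_sigmaBarPlus_sigmaPlus (n : ℕ) (x : Fock) :
    ∑ i ∈ Finset.range (n + 1), sigmaBarPlus i (sigmaPlus (n - i) x) = if n = 0 then x else 0 := by
  induction x using fock_wedge_induction generalizing n with
  | hvac m =>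
    rw [sum_sigmaBarPlus_sigmaPlus_vac, bb_smul_phiBarPlus _ (by omega)]
    simp only [add_sub_cancel_right, sub_add_cancel]
    split_ifs <;> first | rfl | omega
  | hbb k x ih =>
    have hprev : ∀ n : ℕ, ∀ y : Fock, ∑ i ∈ Finset.range (n + 1),
        sigmaBarPlus i (sigmaPlus ((n : ℤ) - 1 - i) y) =
          ∑ i ∈ Finset.range n, sigmaBarPlus i (sigmaPlus ((n : ℤ) - 1 - i) y) := by
      intro n y
      rw [Finset.sum_range_succ, sigmaPlus_of_neg (by omega)]
      simp
    -- This combines `σ_+ b_k = b_k + z σ_+ b_{k+1}` with `σ̄_+ b_k = b_k - z b_{k+1}`. The degree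
    -- drops while `k` rises, hence the inner induction on `n` with `k` free; there the two terms in
    -- `b_{k+1}` cancel.
    have hstep : ∀ (n : ℕ) (k : ℤ), ∑ i ∈ Finset.range (n + 1),
        sigmaBarPlus i (sigmaPlus (n - i) (bb k • x)) =
        ∑ i ∈ Finset.range n, sigmaBarPlus i (sigmaPlus ((n : ℤ) - 1 - i) (bb (k + 1) • x)) +
        bb k • ∑ i ∈ Finset.range (n + 1), sigmaBarPlus i (sigmaPlus (n - i) x) -
        bb (k + 1) • ∑ i ∈ Finset.range n, sigmaBarPlus i (sigmaPlus ((n : ℤ) - 1 - i) x) := by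
      intro n k
      rw [← hprev n (bb (k + 1) • x), add_sub_assoc]
      have e : ∑ i ∈ Finset.range n, sigmaBarPlus i (sigmaPlus ((n : ℤ) - 1 - i) x) =
          ∑ i ∈ Finset.range (n + 1), sigmaBarPlus ((i : ℤ) - 1) (sigmaPlus (n - i) x) := by
        rw [Finset.sum_range_succ', sigmaBarPlus_of_neg (n := ((0 : ℕ) : ℤ) - 1) (by simp),
          LinearMap.zero_apply, add_zero]
        refine Finset.sum_congr rfl fun i _ => ?_
        congr 2
        · push_cast; ring
        · congr 1; push_cast; ring
      rw [e, Finset.smul_sum, Finset.smul_sum, ← Finset.sum_sub_distrib, ← Finset.sum_add_distrib]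
      refine Finset.sum_congr rfl fun i _ => ?_
      rw [sigmaPlus_bb_smul, map_add, sigmaBarPlus_bb_smul,
        show (n : ℤ) - i - 1 = n - 1 - i by ring]
    have hpred : ∀ n : ℕ, ((n + 1 : ℕ) : ℤ) - 1 = n := by intro n; push_cast; ring
    induction n generalizing k with
    | zero =>
      rw [hstep, ih]
      simp
    | succ n ihn =>
      rw [hstep, hpred, ihn, ih, ih]
      split_ifs <;> simp at *
  | hadd x y hx hy =>
    simp only [map_add, Finset.sum_add_distrib, hx, hy]
    split_ifs <;> simp
  | hsmul c x ih =>
    simp only [map_smul, ← Finset.smul_sum, ih]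
    split_ifs <;> simp

theorem mk_sigmaBarPlus_mul_sigmaSer :
    PowerSeries.mk (fun n : ℕ => sigmaBarPlus n) * PowerSeries.map sigmaRing.subtype sigmaSer =
      1 := by
  ext n x
  rw [PowerSeries.coeff_mul, Finset.Nat.sum_antidiagonal_eq_sum_range_succ_mk, LinearMap.sum_apply]
  refine Eq.trans (Finset.sum_congr rfl fun i hi => ?_) ((sum_sigmaBarPlus_sigmaPlus n x).trans ?_)
  · rw [Finset.mem_range] at hi
    rw [PowerSeries.coeff_mk, PowerSeries.coeff_map, sigmaSer, PowerSeries.coeff_mk,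
      Module.End.mul_apply, sigmaPlus, ← Nat.cast_sub (by omega), posCoeff_natCast]
    rfl
  · rw [PowerSeries.coeff_one]
    split_ifs <;> rfl

theorem constantCoeff_sigmaSer :
    PowerSeries.constantCoeff sigmaSer = ((1 : sigmaRingˣ) : sigmaRing) := by
  rw [← PowerSeries.coeff_zero_eq_constantCoeff_apply, sigmaSer, PowerSeries.coeff_mk]
  exact Subtype.ext sigmaPlusN_zero

/-- The coefficients of `σ̄_+` are not known in advance to lie in `sigmaRing`. The comparison is
made over the noncommutative ring `End(F)`, where a left inverse and a right inverse of the same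
series coincide. -/
theorem map_invOfUnit_sigmaSer :
    PowerSeries.map sigmaRing.subtype (PowerSeries.invOfUnit sigmaSer 1) =
      PowerSeries.mk (fun n : ℕ => sigmaBarPlus n) := by
  have h := congrArg (PowerSeries.map sigmaRing.subtype)
    (PowerSeries.mul_invOfUnit sigmaSer 1 constantCoeff_sigmaSer)
  rw [map_mul, map_one] at h
  rw [← one_mul (PowerSeries.map sigmaRing.subtype (PowerSeries.invOfUnit sigmaSer 1)),
    ← mk_sigmaBarPlus_mul_sigmaSer, mul_assoc, h, mul_one]

theorem bosonHom_coeff_Eser (n : ℕ) :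
    bosonHom (PowerSeries.coeff n Eser) =
      PowerSeries.coeff n (PowerSeries.invOfUnit sigmaSer 1) := by
  rw [Eser, PowerSeries.coeff_mk]
  cases n with
  | zero =>
    rw [PowerSeries.coeff_zero_eq_constantCoeff_apply, PowerSeries.constantCoeff_invOfUnit]
    simp
  | succ k =>
    simp only [map_mul, map_pow, map_neg, map_one, bosonHom, MvPolynomial.coe_eval₂Hom,
      MvPolynomial.eval₂_X]
    rw [← mul_assoc, ← mul_pow]
    simp

theorem Eser_smul (n : ℕ) (x : Fock) : PowerSeries.coeff n Eser • x = sigmaBarPlus n x := by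
  change sigmaRing.subtype (bosonHom (PowerSeries.coeff n Eser)) x = _
  rw [bosonHom_coeff_Eser, ← PowerSeries.coeff_map, map_invOfUnit_sigmaSer, PowerSeries.coeff_mk]

theorem EwDivEz_smul (i j : ℤ) (x : Fock) :
    EwDivEz i j • x = sigmaPlus i (sigmaBarPlus j x) := by
  rw [EwDivEz, mul_smul]
  rcases lt_or_ge j 0 with hj | hj
  · rw [posCoeff_of_neg _ hj, sigmaBarPlus_of_neg hj]
    simp
  rcases lt_or_ge i 0 with hi | hi
  · rw [posCoeff_of_neg _ hi, sigmaPlus_of_neg hi]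
    simp
  lift i to ℕ using hi
  lift j to ℕ using hj
  rw [posCoeff_natCast, posCoeff_natCast, Eser_smul, Hser_smul, sigmaPlus, posCoeff_natCast]

/-! ### Products of operator series -/

theorem finite_setOf_apply_ne_zero {P : ℤ → Module.End ℤ Fock} (hP : ∀ n < 0, P n = 0)
    {y : ℤ → Fock} (hy : ∃ N : ℤ, ∀ n < N, y n = 0) (i : ℤ) :
    {n : ℤ | P n (y (i - n)) ≠ 0}.Finite := by
  obtain ⟨N, hN⟩ := hy
  refine (Set.finite_Icc 0 (i - N)).subset fun n hn => ?_
  by_contra h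
  rw [Set.mem_Icc, not_and_or, not_le, not_le] at h
  rcases h with h | h
  · exact hn (by rw [hP n h, LinearMap.zero_apply])
  · exact hn (by rw [hN _ (by omega), map_zero])

/-- The coefficient of `z^i` in the product `P(z) Q(z)`, where `P(z)` is a series in `z` and every
`Q(z) x` is bounded below. -/
def opConv (P Q : ℤ → Module.End ℤ Fock) (hP : ∀ n < 0, P n = 0)
    (hQ : ∀ x, ∃ N : ℤ, ∀ n < N, Q n x = 0) (i : ℤ) : Module.End ℤ Fock where
  toFun x := ∑ᶠ n : ℤ, P n (Q (i - n) x)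
  map_add' x y := by
    simp only [map_add]
    exact finsum_add_distrib (finite_setOf_apply_ne_zero hP (hQ x) i)
      (finite_setOf_apply_ne_zero hP (hQ y) i)
  map_smul' c x := by
    simp only [map_smul]
    exact (smul_finsum' c (finite_setOf_apply_ne_zero hP (hQ x) i)).symm

theorem finsum_sub_one {A : Type*} [AddCommMonoid A] (s : ℤ → A) :
    ∑ᶠ n : ℤ, s (n - 1) = ∑ᶠ n : ℤ, s n :=
  finsum_comp_equiv (Equiv.subRight (1 : ℤ))

theorem finite_sub_one {A : Type*} [AddCommMonoid A] {s : ℤ → A} (hs : s.support.Finite) :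
    (Function.support fun n => s (n - 1)).Finite :=
  hs.preimage (Equiv.subRight (1 : ℤ)).injective.injOn

theorem finite_smul {s : ℤ → Fock} (hs : s.support.Finite) (u : Ext) :
    (Function.support fun n => u • s n).Finite :=
  hs.subset (Function.support_const_smul_subset u s)

/-- The coefficient of `w^j` in `σ̄_+(w) σ_-(w)`. -/
def annihCoeff : ℤ → Module.End ℤ Fock :=
  opConv sigmaBarPlus sigmaMinus (fun _ => sigmaBarPlus_of_neg) exists_sigmaMinus_eq_zero

/-- The coefficient of `z^i` in `σ_+(z) σ̄_-(z)`. -/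
def creatCoeff : ℤ → Module.End ℤ Fock :=
  opConv sigmaPlus sigmaBarMinus (fun _ => sigmaPlus_of_neg) exists_sigmaBarMinus_eq_zero

theorem annihCoeff_apply (j : ℤ) (x : Fock) :
    annihCoeff j x = ∑ᶠ n : ℤ, sigmaBarPlus n (sigmaMinus (j - n) x) := rfl

theorem creatCoeff_apply (i : ℤ) (x : Fock) :
    creatCoeff i x = ∑ᶠ n : ℤ, sigmaPlus n (sigmaBarMinus (i - n) x) := rfl

theorem finite_annihCoeff (j : ℤ) (x : Fock) :
    (Function.support fun n => sigmaBarPlus n (sigmaMinus (j - n) x)).Finite :=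
  finite_setOf_apply_ne_zero (fun _ => sigmaBarPlus_of_neg) (exists_sigmaMinus_eq_zero x) j

theorem finite_creatCoeff (i : ℤ) (x : Fock) :
    (Function.support fun n => sigmaPlus n (sigmaBarMinus (i - n) x)).Finite :=
  finite_setOf_apply_ne_zero (fun _ => sigmaPlus_of_neg) (exists_sigmaBarMinus_eq_zero x) i

theorem annihCoeff_vac (j m : ℤ) : annihCoeff j (vac m) = sigmaBarPlus j (vac m) := by
  rw [annihCoeff_apply, finsum_eq_single _ j]
  · rw [sub_self, sigmaMinus_vac, if_pos rfl]
  · intro n hn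
    rw [sigmaMinus_vac, if_neg (by omega), map_zero]

theorem creatCoeff_vac (i m : ℤ) : creatCoeff i (vac m) = sigmaPlus i (vac m) := by
  rw [creatCoeff_apply, finsum_eq_single _ i]
  · rw [sub_self, sigmaBarMinus_vac, if_pos rfl]
  · intro n hn
    rw [sigmaBarMinus_vac, if_neg (by omega), map_zero]

/-- From `σ_-(w) b_k = w⁻¹ σ_-(w) b_{k-1} + b_k`, followed by `σ̄_+(w) b_k = b_k - b_{k+1} w`. Only
neighbouring values of `k` are related, so a boundary condition at low `k` is still needed. -/
theorem annihCoeff_bb_smul (j k : ℤ) (x : Fock) :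
    annihCoeff j (bb k • x) = annihCoeff (j + 1) (bb (k - 1) • x) + bb k • annihCoeff j x -
      bb (k + 1) • annihCoeff (j - 1) x := by
  have h1 := finite_annihCoeff (j + 1) (bb (k - 1) • x)
  have h2 := finite_annihCoeff j x
  have h3 := finite_annihCoeff (j - 1) x
  rw [annihCoeff_apply, annihCoeff_apply, annihCoeff_apply, annihCoeff_apply,
    smul_finsum' _ h2, ← finsum_sub_one fun n => sigmaBarPlus n (sigmaMinus (j - 1 - n) x),
    smul_finsum' _ (finite_sub_one h3), ← finsum_add_distrib h1 (finite_smul h2 _),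
    ← finsum_sub_distrib ((h1.union (finite_smul h2 _)).subset (Function.support_add _ _))
      (finite_smul (finite_sub_one h3) _)]
  refine finsum_congr fun n => ?_
  rw [sigmaMinus_bb_smul, map_add, sigmaBarPlus_bb_smul, sub_add_eq_add_sub,
    show j - 1 - (n - 1) = j - n by ring, ← add_sub_assoc]

theorem creatCoeff_bb_smul (i k : ℤ) (x : Fock) :
    creatCoeff i (bb k • x) = -(bb (k - 1) • creatCoeff (i + 1) x) := by
  have h1 : (Function.support fun n => sigmaPlus n (bb k • sigmaBarMinus (i - n) x)).Finite := by
    obtain ⟨N, hN⟩ := exists_sigmaBarMinus_eq_zero x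
    exact finite_setOf_apply_ne_zero (y := fun n => bb k • sigmaBarMinus n x)
      (fun _ => sigmaPlus_of_neg) ⟨N, fun n hn => by rw [hN n hn, smul_zero]⟩ i
  have h2 := finite_smul (finite_creatCoeff (i + 1) x) (bb (k - 1))
  -- The first two terms differ by `n ↦ n - 1`, so they cancel after summation over `n`.
  have key : ∀ n, sigmaPlus n (sigmaBarMinus (i - n) (bb k • x)) =
      sigmaPlus n (bb k • sigmaBarMinus (i - n) x) -
        sigmaPlus (n - 1) (bb k • sigmaBarMinus (i - (n - 1)) x) -
        bb (k - 1) • sigmaPlus n (sigmaBarMinus (i + 1 - n) x) := by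
    intro n
    rw [sigmaBarMinus_bb_smul, map_sub, sigmaPlus_bb_smul n (k - 1), sub_add_cancel,
      show i - (n - 1) = i + 1 - n by ring, show i - n + 1 = i + 1 - n by ring]
    abel
  rw [creatCoeff_apply, finsum_congr key, finsum_sub_distrib
      ((h1.union (finite_sub_one h1)).subset (Function.support_sub _ _)) h2,
    finsum_sub_distrib h1 (finite_sub_one h1),
    finsum_sub_one fun n => sigmaPlus n (bb k • sigmaBarMinus (i - n) x), sub_self, zero_sub,
    creatCoeff_apply, smul_finsum' _ (finite_creatCoeff (i + 1) x)]

/-- `σ_+(z) σ̄_-(z) = z^{-m} b(z) ∧ S` on `F_m`, where `S` lowers the charge. -/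
theorem HasCharge.creatCoeff_eq {m : ℤ} {x : Fock} (h : HasCharge m x) (i : ℤ) :
    creatCoeff i x = bb (m + i) • DJKM.fockShift (-1) x := by
  induction h generalizing i with
  | vac m => rw [creatCoeff_vac, sigmaPlus_vac, fockShift_vac, sub_eq_add_neg]
  | @wedge k m x _ ih =>
    rw [creatCoeff_bb_smul, ih, fockShift_bb_smul, bb_smul_bb_smul, neg_neg, ← sub_eq_add_neg,
      add_assoc m 1 i, add_comm 1 i]
  | add _ _ hx hy => rw [map_add, map_add, smul_add, hx, hy]
  | smul c _ hx => rw [map_smul, map_smul, smul_comm, hx]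

/-- By the previous recursion, `annihCoeff j (b_k ∧ x) + b_{k+1} ∧ annihCoeff (j - 1) x` depends on
`j + k` only. Its value can thus be computed for very low `k`, where `b_k ∧ x = 0` and the
hypothesis evaluates the second term. -/
theorem annihCoeff_bb_smul_of_bound {m : ℤ} {x : Fock}
    (h : ∃ N : ℤ, ∀ k < N, ∀ j : ℤ,
      bb k • annihCoeff j x = if j = m + 1 - k then fockShift 1 x else 0) (j k : ℤ) :
    annihCoeff j (bb k • x) =
      (if j = m + 1 - k then fockShift 1 x else 0) - bb (k + 1) • annihCoeff (j - 1) x := by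
  obtain ⟨N, hN⟩ := h
  obtain ⟨K, hK⟩ := exists_bb_smul_eq_zero x
  have base : ∀ k < min (N - 1) K, ∀ j : ℤ, annihCoeff j (bb k • x) =
      (if j = m + 1 - k then fockShift 1 x else 0) - bb (k + 1) • annihCoeff (j - 1) x := by
    intro k hk j
    rw [hK k (by omega), map_zero, hN (k + 1) (by omega)]
    simp only [show (j - 1 = m + 1 - (k + 1)) ↔ (j = m + 1 - k) by omega, sub_self]
  rcases lt_or_ge k (min (N - 1) K) with hk | hk
  · exact base k hk j
  have hk' : min (N - 1) K - 1 ≤ k := by omega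
  clear hk
  induction k, hk' using Int.leInduction generalizing j with
  | base => exact base _ (by omega) j
  | succ k _ ih =>
    rw [annihCoeff_bb_smul, add_sub_cancel_right, ih, add_sub_cancel_right,
      sub_add_cancel]
    simp only [show (j + 1 = m + 1 - k) ↔ (j = m + 1 - (k + 1)) by omega]

/-- This is the boundary condition; `N` must not depend on `j`, because `j` varies along the lines
`j + k` constant. On the vacuum it is the filling of the hole in `phiBarPlus`. For `b_l ∧ x`, the
statement for `x` already yields the exact recursion, which is then wedged with a low `b_k`. -/
theorem HasCharge.bb_smul_annihCoeff_of_lt {m : ℤ} {x : Fock} (h : HasCharge m x) :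
    ∃ N : ℤ, ∀ k < N, ∀ j : ℤ,
      bb k • annihCoeff j x = if j = m + 1 - k then DJKM.fockShift 1 x else 0 := by
  induction h with
  | vac m =>
    refine ⟨m + 1, fun k hk j => ?_⟩
    rw [annihCoeff_vac, fockShift_vac]
    rcases lt_or_ge j 0 with hj | hj
    · rw [sigmaBarPlus_of_neg hj, LinearMap.zero_apply, smul_zero, if_neg (by omega)]
    · lift j to ℕ using hj
      rw [sigmaBarPlus_vac, bb_smul_phiBarPlus _ hk.le]
      exact if_congr (by omega) rfl rfl
  | @wedge l m x _ ih =>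
    have hA := annihCoeff_bb_smul_of_bound ih
    obtain ⟨N, hN⟩ := ih
    obtain ⟨K, hK⟩ := exists_bb_smul_eq_zero (DJKM.fockShift 1 x)
    refine ⟨min N K, fun k hk j => ?_⟩
    rw [hA, smul_sub, smul_ite, hK k (by omega), smul_zero, ite_self, zero_sub, bb_smul_bb_smul,
      neg_neg, hN k (by omega), fockShift_bb_smul, smul_ite, smul_zero]
    exact if_congr (by omega) rfl rfl
  | @add m x y _ _ hx hy =>
    obtain ⟨N, hN⟩ := hx
    obtain ⟨N', hN'⟩ := hy
    refine ⟨min N N', fun k hk j => ?_⟩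
    rw [map_add, smul_add, hN k (by omega), hN' k (by omega), map_add]
    split_ifs <;> simp
  | smul c _ hx =>
    obtain ⟨N, hN⟩ := hx
    refine ⟨N, fun k hk j => ?_⟩
    rw [map_smul, smul_comm, hN k hk, map_smul]
    split_ifs <;> simp

/-- The recursion for `σ̄_+(w) σ_-(w)` on `F_m`. -/
theorem HasCharge.annihCoeff_bb_smul {m : ℤ} {x : Fock} (h : HasCharge m x) (j k : ℤ) :
    annihCoeff j (bb k • x) = (if j = m + 1 - k then DJKM.fockShift 1 x else 0) -
      bb (k + 1) • annihCoeff (j - 1) x :=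
  annihCoeff_bb_smul_of_bound h.bb_smul_annihCoeff_of_lt j k

theorem HasCharge.annihCoeff {m : ℤ} {x : Fock} (h : HasCharge m x) (j : ℤ) :
    HasCharge m (annihCoeff j x) := by
  induction h generalizing j with
  | vac m =>
    rw [annihCoeff_vac]
    rcases lt_or_ge j 0 with hj | hj
    · rw [sigmaBarPlus_of_neg hj]
      exact HasCharge.zero m
    · lift j to ℕ using hj
      rw [sigmaBarPlus_vac]
      exact hasCharge_phiBarPlus m j
  | @wedge k m x hx ih =>
    rw [hx.annihCoeff_bb_smul]
    refine HasCharge.sub ?_ ((ih _).wedge _)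
    split_ifs
    · exact hx.fockShift 1
    · exact HasCharge.zero _
  | add _ _ hx hy => rw [map_add]; exact (hx j).add (hy j)
  | smul c _ hx => rw [map_smul]; exact (hx j).smul c

theorem HasCharge.creatCoeff_annihCoeff {m : ℤ} {x : Fock} (h : HasCharge m x) (i j : ℤ) :
    creatCoeff i (DJKM.annihCoeff j x) =
      bb (m + i) • DJKM.fockShift (-1) (DJKM.annihCoeff j x) :=
  (h.annihCoeff j).creatCoeff_eq i

/-- `S⁻¹` turns `b_{k+1}` back into `b_k`, and moving `b_k` past the created vector cancels the sign
of the annihilation rule. The result is a Leibniz rule. -/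
theorem HasCharge.creatCoeff_annihCoeff_bb_smul {m : ℤ} {x : Fock} (h : HasCharge m x)
    (i j k : ℤ) :
    creatCoeff i (DJKM.annihCoeff j (bb k • x)) =
      (if j = m + 1 - k then bb (m + 1 + i) • x else 0) +
        bb k • creatCoeff (i + 1) (DJKM.annihCoeff (j - 1) x) := by
  rw [(h.wedge k).creatCoeff_annihCoeff, h.creatCoeff_annihCoeff, h.annihCoeff_bb_smul, map_sub,
    fockShift_bb_smul, add_neg_cancel_right, smul_sub, bb_smul_bb_smul _ k, sub_neg_eq_add,
    add_assoc m 1 i, add_comm 1 i]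
  congr 1
  split_ifs
  · rw [fockShift_neg_fockShift]
  · rw [map_zero, smul_zero]

/-! ### The action of elementary matrices -/

/-- The formula for `deltaFock` applies directly only over vacua on which `A` vanishes. Unwrapping
`[b]_m` down to level `N` brings every element into that form. -/
theorem deltaFock_smul (A : Module.End ℤ FreeM) (hA : ∃ N, ∀ l ≤ N, A (bvec l) = 0) (u : Ext)
    (x : Fock) : deltaFock A (u • x) = deltaExt A u • x + u • deltaFock A x := by
  obtain ⟨N, hN⟩ := hA
  induction x using fock_induction with
  | hadd x y hx hy => simp only [smul_add, map_add, hx, hy]; abel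
  | hp v m =>
    obtain ⟨k, w, hk, e⟩ : ∃ (k : ℤ) (w : Ext), k ≤ N ∧ wedgeVac v m = wedgeVac w k := by
      rcases le_or_gt m N with h | h
      · exact ⟨m, v, h, rfl⟩
      · obtain ⟨n, rfl⟩ := Int.le.dest h.le
        exact ⟨N, v * bDown (N + n) N, le_rfl, (wedgeVac_mul_bDown v N n).symm⟩
    have hk' : ∀ l ≤ k, A (bvec l) = 0 := fun l hl => hN l (hl.trans hk)
    rw [e, smul_wedgeVac, deltaFock_wedgeVac A k hk', deltaFock_wedgeVac A k hk', deltaExt_mul,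
      wedgeVac_add, smul_wedgeVac, smul_wedgeVac]

theorem elemMat_bvec_of_lt {i j l : ℤ} (h : l < j) : elemMat i j (bvec l) = 0 := by
  rw [elemMat_bvec, if_neg h.ne]

theorem deltaFock_elemMat_bb_smul (i j k : ℤ) (x : Fock) :
    deltaFock (elemMat i j) (bb k • x) =
      (if k = j then bb i • x else 0) + bb k • deltaFock (elemMat i j) x := by
  rw [deltaFock_smul _ ⟨j - 1, fun l hl => elemMat_bvec_of_lt (by omega)⟩, bb, deltaExt_ι,
    elemMat_bvec]
  split_ifs
  · rfl
  · simp

theorem deltaFock_elemMat_vac_of_lt {i j m : ℤ} (h : m < j) :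
    deltaFock (elemMat i j) (vac m) = 0 := by
  rw [vac, deltaFock_wedgeVac _ m fun l hl => elemMat_bvec_of_lt (by omega)]
  have h1 : deltaExt (elemMat i j) 1 = 0 := by simpa using deltaExt_mul (elemMat i j) 1 1
  rw [h1, wedgeVac_zero]

/-- `δ(B_{ij})` acts on `F_m` as `b_i ∧ S σ̄_+(w) σ_-(w)`, up to a power of `w`. -/
theorem HasCharge.deltaFock_elemMat {m : ℤ} {x : Fock} (h : HasCharge m x) (i j : ℤ) :
    deltaFock (elemMat i j) x = creatCoeff (i - m) (DJKM.annihCoeff (m - j) x) := by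
  induction h with
  | vac m =>
    have low : ∀ m < j, deltaFock (elemMat i j) (DJKM.vac m) =
        creatCoeff (i - m) (DJKM.annihCoeff (m - j) (DJKM.vac m)) := fun m hm => by
      rw [deltaFock_elemMat_vac_of_lt hm, annihCoeff_vac, sigmaBarPlus_of_neg (by omega),
        LinearMap.zero_apply, map_zero]
    rcases lt_or_ge m j with hm | hm
    · exact low m hm
    have hm' : j - 1 ≤ m := by omega
    clear hm
    -- The start `m = j - 1` is a vacuum killed by both sides; each higher one is `[b]_{m+1} =
    -- b_{m+1} ∧ [b]_m`, to which the two Leibniz rules apply.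
    induction m, hm' using Int.leInduction with
    | base => exact low _ (by omega)
    | succ m _ ih =>
      have e := bb_smul_vac_sub_one (m + 1)
      rw [add_sub_cancel_right] at e
      rw [← e, deltaFock_elemMat_bb_smul, (HasCharge.vac m).creatCoeff_annihCoeff_bb_smul, ih,
        show i - (m + 1) + 1 = i - m by ring, show m + 1 - j - 1 = m - j by ring,
        show m + 1 + (i - (m + 1)) = i by ring]
      exact congrArg (· + _) (if_congr (by omega) rfl rfl)
  | @wedge k m x hx ih =>
    rw [deltaFock_elemMat_bb_smul, hx.creatCoeff_annihCoeff_bb_smul, ih,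
      show i - (m + 1) + 1 = i - m by ring, show m + 1 - j - 1 = m - j by ring,
      show m + 1 + (i - (m + 1)) = i by ring]
    exact congrArg (· + _) (if_congr (by omega) rfl rfl)
  | add _ _ hx hy => simp only [map_add, hx, hy]
  | smul c _ hx => simp only [map_smul, hx]

theorem HasCharge.hasCharge_deltaFock {m : ℤ} {x : Fock} (h : HasCharge m x) (i j : ℤ) :
    HasCharge m (deltaFock (elemMat i j) x) := by
  rw [h.deltaFock_elemMat, h.creatCoeff_annihCoeff]
  simpa using ((h.annihCoeff (m - j)).fockShift (-1)).wedge (m + (i - m))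

/-! ### The commutation relation of `σ̄_-(z)` and `σ̄_+(w)` -/

/-- As series, `σ̄_-(z) σ̄_+(w)[b]_m = (1 - w/z)⁻¹ σ̄_+(w)[b]_m`. In the recursion for `phiBarPlus`,
the correction term `b_m z⁻¹` contributes only when it fills the hole, that is for `s = n + 1`,
where it yields the vacuum. -/
theorem sigmaBarMinus_phiBarPlus (n s : ℕ) (m : ℤ) :
    sigmaBarMinus (-s) (phiBarPlus m n) = if s ≤ n then phiBarPlus m (n - s) else 0 := by
  induction n generalizing s m with
  | zero =>
    rw [phiBarPlus_zero, sigmaBarMinus_vac]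
    rcases Nat.eq_zero_or_pos s with rfl | hs
    · simp [phiBarPlus_zero]
    · rw [if_neg (by omega), if_neg (by omega)]
  | succ n ih =>
    rw [phiBarPlus_succ, map_neg, sigmaBarMinus_bb_smul, add_sub_cancel_right, ih]
    cases s with
    | zero =>
      rw [sigmaBarMinus_of_pos (by simp)]
      simp [phiBarPlus_succ]
    | succ s =>
      rw [show -((s + 1 : ℕ) : ℤ) + 1 = -s by push_cast; ring, ih]
      rcases lt_trichotomy s n with h | rfl | h
      · rw [if_pos (by omega), if_pos (by omega), if_pos (by omega),
          bb_smul_phiBarPlus _ (show m ≤ m - 1 + 1 by omega), if_neg (by omega), sub_zero,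
          show n + 1 - (s + 1) = (n - (s + 1)) + 1 by omega, phiBarPlus_succ]
      · rw [if_neg (by omega), if_pos le_rfl, if_pos le_rfl, Nat.sub_self, Nat.sub_self,
          smul_zero, zero_sub, neg_neg, phiBarPlus_zero, phiBarPlus_zero, bb_smul_vac_sub_one]
      · rw [if_neg (by omega), if_neg (by omega), if_neg (by omega)]
        simp

/-- `(1 - w/z) σ̄_-(z) σ̄_+(w) = σ̄_+(w) σ̄_-(z)`. -/
theorem sigmaBarMinus_sigmaBarPlus (i j : ℤ) (x : Fock) :
    sigmaBarMinus i (sigmaBarPlus j x) - sigmaBarMinus (i + 1) (sigmaBarPlus (j - 1) x) =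
      sigmaBarPlus j (sigmaBarMinus i x) := by
  induction x using fock_wedge_induction generalizing i j with
  | hvac m =>
    rcases lt_or_ge j 0 with hj | hj
    · simp [sigmaBarPlus_of_neg hj, sigmaBarPlus_of_neg (show j - 1 < 0 by omega)]
    rcases lt_or_ge 0 i with hi | hi
    · simp [sigmaBarMinus_of_pos hi, sigmaBarMinus_of_pos (show 0 < i + 1 by omega)]
    lift j to ℕ using hj
    obtain ⟨s, rfl⟩ : ∃ s : ℕ, i = -s := ⟨(-i).toNat, by omega⟩
    rw [sigmaBarPlus_vac, sigmaBarMinus_phiBarPlus, sigmaBarMinus_vac]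
    cases s with
    | zero => simp [sigmaBarMinus_of_pos, sigmaBarPlus_vac]
    | succ s =>
      rw [if_neg (show ¬ -((s + 1 : ℕ) : ℤ) = 0 by omega), map_zero]
      cases j with
      | zero => simp [sigmaBarPlus_of_neg]
      | succ j =>
        rw [show -((s + 1 : ℕ) : ℤ) + 1 = -s by push_cast; ring,
          show ((j + 1 : ℕ) : ℤ) - 1 = j by push_cast; ring, sigmaBarPlus_vac,
          sigmaBarMinus_phiBarPlus]
        simp
  | hbb k x ih =>
    -- On a factor `b_k` both operators are polynomials in commuting shifts, so the relation passes
    -- through it unchanged.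
    simp only [sigmaBarPlus_bb_smul, sigmaBarMinus_bb_smul, map_sub, ← ih, smul_sub,
      add_sub_cancel_right, sub_add_cancel]
    abel
  | hadd x y hx hy => simp only [map_add, ← hx, ← hy]; abel
  | hsmul c x ih => simp only [map_smul, ← ih, smul_sub]

/-! ### Formal distributions -/

theorem applyW_sigmaMinus_constDist (v : Fock) (i j : ℤ) :
    applyW sigmaMinus (constDist v) i j = if i = 0 then sigmaMinus j v else 0 := by
  rw [applyW, finsum_eq_single _ j]
  · simp only [constDist, sub_self, and_true]
    split_ifs <;> simp
  · intro n hn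
    rw [constDist, if_neg (by omega), map_zero]

theorem definedMul_zwPow (m : ℤ) (f : FormalDist Fock) : DefinedMul (zwPow m) f := by
  intro i j
  refine (Set.finite_singleton (m, -m)).subset fun p hp => ?_
  by_contra h
  refine hp ?_
  rw [zwPow, if_neg (fun e => h (Prod.ext e.1 e.2)), zero_smul]

theorem mulDist_zwPow (m : ℤ) (f : FormalDist Fock) (i j : ℤ) :
    mulDist (zwPow m) f i j = f (i - m) (j + m) := by
  rw [mulDist, finsum_eq_single _ (m, -m)]
  · simp [zwPow]
  · intro p hp
    rw [zwPow, if_neg (fun e => hp (Prod.ext e.1 e.2)), zero_smul]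

theorem support_iotaZW_smul_subset {f : FormalDist Fock} {N : ℤ}
    (hf : ∀ i j : ℤ, j < N → f i j = 0) (i j : ℤ) :
    (Function.support fun p : ℤ × ℤ => iotaZW p.1 p.2 • f (i - p.1) (j - p.2)) ⊆
      ((Finset.range (j - N + 1).toNat).image fun t : ℕ => ((-t : ℤ), (t : ℤ)) :
        Finset (ℤ × ℤ)) := by
  rintro ⟨a, b⟩ hp
  simp only [Function.mem_support, iotaZW] at hp
  have h : 0 ≤ b ∧ a = -b := by
    by_contra h
    exact hp (by rw [if_neg h, zero_smul])
  have hb : N ≤ j - b := by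
    by_contra hb
    exact hp (by rw [hf _ _ (by omega), smul_zero])
  simp only [Finset.coe_image, Finset.coe_range, Set.mem_image, Set.mem_Iio, Prod.mk.injEq]
  exact ⟨b.toNat, by omega, by omega, by omega⟩

theorem definedMul_iotaZW {f : FormalDist Fock} {N : ℤ}
    (hf : ∀ i j : ℤ, j < N → f i j = 0) : DefinedMul iotaZW f :=
  fun i j => (Finset.finite_toSet _).subset (support_iotaZW_smul_subset hf i j)

/-- Division by `1 - w/z`. -/
theorem mulDist_iotaZW_eq {f g : FormalDist Fock} {N : ℤ}
    (hf : ∀ i j : ℤ, j < N → f i j = 0)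
    (hg : ∀ i j : ℤ, g i j = f i j - f (i + 1) (j - 1)) : mulDist iotaZW g = f := by
  have hg0 : ∀ i j : ℤ, j < N → g i j = 0 := fun i j hj => by
    rw [hg, hf i j hj, hf _ _ (by omega), sub_zero]
  funext i j
  rw [mulDist, finsum_eq_sum_of_support_subset _ (support_iotaZW_smul_subset hg0 i j),
    Finset.sum_image (by intro a _ b _ h; simpa using h)]
  have e : ∀ t : ℕ, iotaZW (-t : ℤ) t • g (i - -t) (j - t) =
      f (i + t) (j - t) - f (i + (t + 1 : ℕ)) (j - (t + 1 : ℕ)) := fun t => by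
    rw [iotaZW, if_pos (by omega), one_smul, hg, sub_neg_eq_add]
    push_cast
    rw [add_assoc, sub_sub]
  simp only [e]
  -- The sum telescopes; its last term has `w`-degree below `N` and vanishes.
  rw [Finset.sum_range_sub' fun t : ℕ => f (i + t) (j - t)]
  rw [hf _ (j - ((j - N + 1).toNat : ℕ)) (by omega)]
  simp

theorem definedMul_EwDivEz {c : FormalDist Fock} {N L : ℤ} (hN : ∀ i j : ℤ, j < N → c i j = 0)
    (hL : ∀ i j : ℤ, i < L → c i j = 0) : DefinedMul EwDivEz c := by
  intro i j
  refine ((Set.finite_Icc 0 (i - L)).prod (Set.finite_Icc 0 (j - N))).subset ?_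
  rintro ⟨a, b⟩ hp
  by_contra h
  refine hp ?_
  rw [EwDivEz_smul]
  simp only [Set.mem_prod, Set.mem_Icc, not_and_or, not_le] at h
  rcases h with (h | h) | (h | h)
  · rw [sigmaPlus_of_neg h, LinearMap.zero_apply]
  · rw [hL _ _ (by omega), map_zero, map_zero]
  · rw [sigmaBarPlus_of_neg h, LinearMap.zero_apply, map_zero]
  · rw [hN _ _ (by omega), map_zero, map_zero]

/-- Bounds below in both variables make the double sum finite, hence iterable; `EwDivEz_smul` then
identifies the action of each coefficient. -/
theorem mulDist_EwDivEz {c : FormalDist Fock} {N L : ℤ} (hN : ∀ i j : ℤ, j < N → c i j = 0)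
    (hL : ∀ i j : ℤ, i < L → c i j = 0) :
    mulDist EwDivEz c = applyZ sigmaPlus (applyW sigmaBarPlus c) := by
  funext i j
  rw [mulDist, finsum_curry _ (definedMul_EwDivEz hN hL i j), applyZ]
  refine finsum_congr fun a => ?_
  refine Eq.trans (finsum_congr fun b => EwDivEz_smul a b _)
    ((sigmaPlus a).toAddMonoidHom.map_finsum ?_).symm
  exact finite_setOf_apply_ne_zero (y := fun n => c (i - a) n) (fun _ => sigmaBarPlus_of_neg)
    ⟨N, fun n hn => hN _ n hn⟩ j

end DJKM

end

/-! ### Assembly of the three formulas -/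

open DJKM in
theorem mainTheorem1 (m : ℤ) (v : DJKM.Fock) (hv : v ∈ DJKM.fockCharge m) :
    -- `a = σ_-(w) v`
    let a := DJKM.applyW DJKM.sigmaMinus (DJKM.constDist v)
    -- `f = σ_+(z) σ̄_-(z) σ̄_+(w) σ_-(w) v`
    let f₁ := DJKM.applyW DJKM.sigmaBarPlus a
    let f₂ := DJKM.applyZ DJKM.sigmaBarMinus f₁
    let f := DJKM.applyZ DJKM.sigmaPlus f₂
    -- `c = σ̄_-(z) σ_-(w) v`
    let c := DJKM.applyZ DJKM.sigmaBarMinus a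
    -- `g = σ_+(z) σ̄_+(w) σ̄_-(z) σ_-(w) v`
    let g₁ := DJKM.applyW DJKM.sigmaBarPlus c
    let g := DJKM.applyZ DJKM.sigmaPlus g₁
    -- `h = (E(w) / E(z)) σ̄_-(z) σ_-(w) v`
    let h := DJKM.mulDist DJKM.EwDivEz c
    -- all the products of series involved are well defined, coefficient by coefficient
    (DJKM.DefinedW DJKM.sigmaMinus (DJKM.constDist v) ∧
      DJKM.DefinedW DJKM.sigmaBarPlus a ∧
      DJKM.DefinedZ DJKM.sigmaBarMinus f₁ ∧
      DJKM.DefinedZ DJKM.sigmaPlus f₂ ∧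
      DJKM.DefinedZ DJKM.sigmaBarMinus a ∧
      DJKM.DefinedW DJKM.sigmaBarPlus c ∧
      DJKM.DefinedZ DJKM.sigmaPlus g₁ ∧
      DJKM.DefinedMul DJKM.EwDivEz c ∧
      DJKM.DefinedMul DJKM.iotaZW g ∧
      DJKM.DefinedMul DJKM.iotaZW h ∧
      DJKM.DefinedMul (DJKM.zwPow m) f ∧
      DJKM.DefinedMul (DJKM.zwPow m) (DJKM.mulDist DJKM.iotaZW g) ∧
      DJKM.DefinedMul (DJKM.zwPow m) (DJKM.mulDist DJKM.iotaZW h)) ∧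
    -- `gl_∞` acts on `F_m`
    (∀ i j : ℤ, DJKM.deltaFock (DJKM.elemMat i j) v ∈ DJKM.fockCharge m) ∧
    -- the three expressions of `δ_m(z,w) v`
    DJKM.deltaSeries v = DJKM.mulDist (DJKM.zwPow m) f ∧
    DJKM.deltaSeries v = DJKM.mulDist (DJKM.zwPow m) (DJKM.mulDist DJKM.iotaZW g) ∧
    DJKM.deltaSeries v = DJKM.mulDist (DJKM.zwPow m) (DJKM.mulDist DJKM.iotaZW h) := by
  have hc : HasCharge m v := hasCharge_of_mem_fockCharge hv
  obtain ⟨N, hN⟩ := exists_sigmaMinus_eq_zero v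
  intro a f₁ f₂ f c g₁ g h
  have ha : ∀ i j, a i j = if i = 0 then sigmaMinus j v else 0 := applyW_sigmaMinus_constDist v
  have ha0 : ∀ i j, j < N → a i j = 0 := fun i j hj => by rw [ha, hN j hj, ite_self]
  have hf₁ : ∀ i j, f₁ i j = if i = 0 then annihCoeff j v else 0 := fun i j => by
    change ∑ᶠ n : ℤ, sigmaBarPlus n (a i (j - n)) = _
    simp only [ha]
    split_ifs
    · rfl
    · simp
  have hf₂ : ∀ i j, f₂ i j = sigmaBarMinus i (annihCoeff j v) := fun i j => by
    change ∑ᶠ n : ℤ, sigmaBarMinus n (f₁ (i - n) j) = _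
    rw [finsum_eq_single _ i]
    · rw [hf₁, sub_self, if_pos rfl]
    · intro n hn
      rw [hf₁, if_neg (by omega), map_zero]
  have hf : ∀ i j, f i j = creatCoeff i (annihCoeff j v) := fun i j => by
    change ∑ᶠ n : ℤ, sigmaPlus n (f₂ (i - n) j) = _
    simp only [hf₂]
    rfl
  have hcc : ∀ i j, c i j = sigmaBarMinus i (sigmaMinus j v) := fun i j => by
    change ∑ᶠ n : ℤ, sigmaBarMinus n (a (i - n) j) = _
    rw [finsum_eq_single _ i]
    · rw [ha, sub_self, if_pos rfl]
    · intro n hn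
      rw [ha, if_neg (by omega), map_zero]
  have hcN : ∀ i j, j < N → c i j = 0 := fun i j hj => by rw [hcc, hN j hj, map_zero]
  -- Only the degrees `N ≤ j ≤ 0` of `σ_-(w) v` can be nonzero, so one lower bound in `z` serves
  -- every `j`.
  obtain ⟨L, hL⟩ := exists_common_bound
    (fun j => exists_sigmaBarMinus_eq_zero (sigmaMinus j v)) N 0
  have hcL : ∀ i j, i < L → c i j = 0 := fun i j hi => by
    rw [hcc]
    rcases lt_or_ge j N with h1 | h1
    · rw [hN j h1, map_zero]
    rcases lt_or_ge 0 j with h2 | h2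
    · rw [sigmaMinus_of_pos h2, LinearMap.zero_apply, map_zero]
    · exact hL j h1 h2 i hi
  have hA0 : ∀ j < N, annihCoeff j v = 0 := fun j hj => by
    rw [annihCoeff_apply]
    refine finsum_eq_zero_of_forall_eq_zero fun n => ?_
    rcases lt_or_ge n 0 with hn | hn
    · rw [sigmaBarPlus_of_neg hn, LinearMap.zero_apply]
    · rw [hN _ (by omega), map_zero]
  have hf0 : ∀ i j, j < N → f i j = 0 := fun i j hj => by rw [hf, hA0 j hj, map_zero]
  -- The commutation relation, summed against `σ_-(w) v`: `g₁ = (1 - w/z) f₂`. Finiteness lets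
  -- `σ̄_-` pass through the sums.
  have hg₁ : ∀ i j, g₁ i j = f₂ i j - f₂ (i + 1) (j - 1) := fun i j => by
    change ∑ᶠ n : ℤ, sigmaBarPlus n (c i (j - n)) = _
    have h1 := finite_annihCoeff j v
    have h2 := finite_sub_one (finite_annihCoeff (j - 1) v)
    rw [hf₂, hf₂, annihCoeff_apply, annihCoeff_apply,
      ← finsum_sub_one fun n => sigmaBarPlus n (sigmaMinus (j - 1 - n) v)]
    refine Eq.trans ?_ (congrArg₂ (· - ·)
      ((sigmaBarMinus i).toAddMonoidHom.map_finsum h1).symm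
      ((sigmaBarMinus (i + 1)).toAddMonoidHom.map_finsum h2).symm)
    refine Eq.trans ?_ (finsum_sub_distrib
      (h1.subset (Function.support_comp_subset (map_zero (sigmaBarMinus i)) _))
      (h2.subset (Function.support_comp_subset (map_zero (sigmaBarMinus (i + 1))) _)))
    refine finsum_congr fun n => ?_
    rw [hcc, ← sigmaBarMinus_sigmaBarPlus, show j - 1 - (n - 1) = j - n by ring]
    rfl
  have hf₂bound : ∀ j, ∃ K : ℤ, ∀ i < K, f₂ i j = 0 := fun j => by
    simp only [hf₂]
    exact exists_sigmaBarMinus_eq_zero _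
  have hg₁bound : ∀ j, ∃ K : ℤ, ∀ i < K, g₁ i j = 0 := fun j => by
    obtain ⟨K, hK⟩ := hf₂bound j
    obtain ⟨K', hK'⟩ := hf₂bound (j - 1)
    exact ⟨min K (K' - 1), fun i hi => by
      rw [hg₁, hK i (by omega), hK' (i + 1) (by omega), sub_zero]⟩
  have hpos : ∀ n < 0, sigmaPlus n = 0 := fun _ => sigmaPlus_of_neg
  have hbarpos : ∀ n < 0, sigmaBarPlus n = 0 := fun _ => sigmaBarPlus_of_neg
  have hg : ∀ i j, g i j = f i j - f (i + 1) (j - 1) := fun i j => by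
    change ∑ᶠ n : ℤ, sigmaPlus n (g₁ (i - n) j) =
      ∑ᶠ n : ℤ, sigmaPlus n (f₂ (i - n) j) - ∑ᶠ n : ℤ, sigmaPlus n (f₂ (i + 1 - n) (j - 1))
    rw [← finsum_sub_distrib (finite_setOf_apply_ne_zero hpos (hf₂bound j) i)
      (finite_setOf_apply_ne_zero hpos (hf₂bound (j - 1)) (i + 1))]
    refine finsum_congr fun n => ?_
    rw [hg₁, map_sub, sub_add_eq_add_sub]
  have hg0 : ∀ i j, j < N → g i j = 0 := fun i j hj => by
    rw [hg, hf0 i j hj, hf0 _ _ (by omega), sub_zero]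
  have hhg : h = g := mulDist_EwDivEz hcN hcL
  have hδ : deltaSeries v = mulDist (zwPow m) f := by
    funext i j
    -- The prefactor `z^m/w^m` supplies exactly the index shifts `i - m` and `j + m`; the matrix
    -- column is `-j`.
    rw [mulDist_zwPow, hf, deltaSeries, hc.deltaFock_elemMat, sub_neg_eq_add, add_comm m j]
  have hι : mulDist iotaZW g = f := mulDist_iotaZW_eq hf0 hg
  have hsingle : ∀ (P : ℤ → Module.End ℤ Fock) (y : ℤ → Fock) (i : ℤ), (∀ n ≠ 0, y n = 0) →
      {n : ℤ | P n (y (i - n)) ≠ 0}.Finite := fun P y i hy =>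
    (Set.finite_singleton i).subset fun n hn => by
      by_contra hne
      exact hn (by rw [hy _ (fun e => hne (by simp; omega)), map_zero])
  refine ⟨⟨fun i j => ?_, fun i j => ?_, fun i j => ?_, fun i j => ?_, fun i j => ?_,
    fun i j => ?_, fun i j => ?_, definedMul_EwDivEz hcN hcL, definedMul_iotaZW hg0, ?_,
    definedMul_zwPow m _, definedMul_zwPow m _, definedMul_zwPow m _⟩,
    fun i j => (hc.hasCharge_deltaFock i j).mem_fockCharge, hδ, ?_, ?_⟩
  · exact hsingle _ (constDist v i) j fun n hn => if_neg fun e => hn e.2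
  · exact finite_setOf_apply_ne_zero hbarpos ⟨N, fun n hn => ha0 i n hn⟩ j
  · exact hsingle _ (fun n => f₁ n j) i fun n hn => by rw [hf₁, if_neg hn]
  · exact finite_setOf_apply_ne_zero hpos (hf₂bound j) i
  · exact hsingle _ (fun n => a n j) i fun n hn => by rw [ha, if_neg hn]
  · exact finite_setOf_apply_ne_zero hbarpos ⟨N, fun n hn => hcN i n hn⟩ j
  · exact finite_setOf_apply_ne_zero hpos (hg₁bound j) i
  · rw [hhg]
    exact definedMul_iotaZW hg0
  · rw [hι, hδ]
  · rw [hhg, hι, hδ]
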